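/- Work over $\mathbb{C}$. Let $A,B\in\mathbb{C}[z_0,z_1,z_2]$ be homogeneous of degrees $4$ and $6$ with $4A^3+27B^2\neq 0$, let $Y\subset\mathbb{P}(2,3,1,1,1)$ be the elliptic threefold $y^2=x^3+Ax+B$, and let $\pi:Y\dashrightarrow\mathbb{P}^2$ be the projection $[x:y:z_0:z_1:z_2]\mapsto[z_0:z_1:z_2]$. Let $\Delta_{\mathrm{red}}\subset\mathbb{P}^2$ be the reduced curve defined by the vanishing of $4A^3+27B^2$. Let $\mathrm{MW}(\pi)$ be the group of rational sections of $\pi$; these are the maps $z\mapsto[f(z):g(z):h(z)z_0:h(z)z_1:h(z)z_2]$ with $f,g,h$ homogeneous polynomials of degrees $2n+2$, $3n+3$, $n$ for some $n\ge 0$, not all zero, such that $g^2=f^3+Afh^4+Bh^6$; the group law is fibrewise addition, and $h=0$ gives the zero section. For a line $\ell\subset\mathbb{P}^2$ that is not a component of $\Delta_{\mathrm{red}}$, let $\pi_\ell:Y_\ell\dashrightarrow\ell$ be the part of $\pi$ over $\ell$ (a rational elliptic surface), let $\mathrm{MW}(\pi_\ell)$ be its group of rational sections, and consider the map $\mathrm{MW}(\pi)\to\mathrm{MW}(\pi_\ell)$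 given by restriction of sections to $\ell$ (write a section with $f,g,h$ that do not all vanish on $\ell$, and restrict $f,g,h$ to $\ell$). (1) For a very general line $\ell$, that is, for every line outside a countable union of proper Zariski-closed subsets of the dual projective plane, $\ell$ is not a component of $\Delta_{\mathrm{red}}$, and restriction of sections is a well-defined injective group homomorphism $\mathrm{MW}(\pi)\to\mathrm{MW}(\pi_\ell)$. (2) If $\Delta_{\mathrm{red}}$ is neither a union of lines nor an irreducible conic, then there is a line $\ell$, not a component of $\Delta_{\mathrm{red}}$, such that $\ell$ is the tangent line of $\Delta_{\mathrm{red}}$ at some smooth point of $\Delta_{\mathrm{red}}$, $\ell$ meets $\Delta_{\mathrm{red}}$ in at least two distinct points, and restriction of sections is a well-defined injective group homomorphism $\mathrm{MW}(\pi)\to\mathrm{MW}(\pi_\ell)$. -/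

import Mathlib

noncomputable section

namespace EllThreefold

open MvPolynomial

/-! ### Rational sections of a Weierstrass fibration over a projective variety

`R` is the homogeneous coordinate ring of a projective variety `V` (below: the plane, or a line
in it), graded by `𝒜`, and `a`, `b` are homogeneous of degrees `4` and `6`.  They define
`Y : y² = x³ + a x + b` in weighted projective space (`x` and `y` have weights `2` and `3`), fibred
over `V`. -/

section Sections

variable {R : Type*} [CommRing R] [IsDomain R] [Algebra ℂ R] (𝒜 : ℕ → Submodule ℂ R)

instance fractionRingDecidableEq : DecidableEq (FractionRing R) := Classical.decEq _

/-- The curve `y² = x³ + a x + b` over the fraction field of the homogeneous coordinate ring. -/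
def genericCurve (a b : R) : WeierstrassCurve.Affine (FractionRing R) :=
  ⟨0, 0, 0, algebraMap R (FractionRing R) a, algebraMap R (FractionRing R) b⟩

/-- The triple `(f, g, h)` defines a rational map `z ↦ [f(z) : g(z) : h(z) z]` from `V` to
weighted projective space whose image lies on `y² = x³ + a x + b`:
the entries are homogeneous of degrees `2n + 2`, `3n + 3`, `n`, they are not all zero, and they
satisfy the equation. -/
structure IsSectionTriple (a b f g h : R) : Prop where
  homogeneous : ∃ n : ℕ, f ∈ 𝒜 (2 * n + 2) ∧ g ∈ 𝒜 (3 * n + 3) ∧ h ∈ 𝒜 n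
  ne_zero : ¬ (f = 0 ∧ g = 0 ∧ h = 0)
  equation : g ^ 2 = f ^ 3 + a * f * h ^ 4 + b * h ^ 6

/-- The point of the generic curve that corresponds to the rational section
`z ↦ [f(z) : g(z) : h(z) z]`: the point `(f / h², g / h³)` if `h ≠ 0`, and the zero point
(the zero section) if `h = 0`. -/
def Represents (a b : R) (P : (genericCurve a b).Point) (f g h : R) : Prop :=
  IsSectionTriple 𝒜 a b f g h ∧
    match P with
    | .zero => h = 0
    | .some x y _ => h ≠ 0 ∧
        x = algebraMap R (FractionRing R) f / algebraMap R (FractionRing R) h ^ 2 ∧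
        y = algebraMap R (FractionRing R) g / algebraMap R (FractionRing R) h ^ 3

/-- Quotients of homogeneous elements, of degree `d`. -/
def IsHomogeneousFraction (d : ℕ) (x : FractionRing R) : Prop :=
  ∃ (n : ℕ) (f h : R), f ∈ 𝒜 (n + d) ∧ h ∈ 𝒜 n ∧ h ≠ 0 ∧
    x = algebraMap R (FractionRing R) f / algebraMap R (FractionRing R) h

variable {𝒜}

theorem algebraMap_ne_zero {S : Type*} [CommRing S] {h : S} (hh : h ≠ 0) :
    algebraMap S (FractionRing S) h ≠ 0 := by
  simpa using hh

theorem IsHomogeneousFraction.of_mem {d : ℕ} {f : R} [SetLike.GradedMonoid 𝒜] (hf : f ∈ 𝒜 d) :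
    IsHomogeneousFraction 𝒜 d (algebraMap R (FractionRing R) f) :=
  ⟨0, f, 1, by simpa using hf, SetLike.GradedOne.one_mem, one_ne_zero, by simp⟩

theorem IsHomogeneousFraction.add {d : ℕ} {x y : FractionRing R} [SetLike.GradedMonoid 𝒜]
    (hx : IsHomogeneousFraction 𝒜 d x) (hy : IsHomogeneousFraction 𝒜 d y) :
    IsHomogeneousFraction 𝒜 d (x + y) := by
  obtain ⟨n, f, h, hf, hh, h0, rfl⟩ := hx
  obtain ⟨m, g, k, hg, hk, k0, rfl⟩ := hy
  refine ⟨n + m, f * k + h * g, h * k, ?_, SetLike.mul_mem_graded hh hk, mul_ne_zero h0 k0, ?_⟩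
  · refine add_mem ?_ ?_
    · have := SetLike.mul_mem_graded hf hk
      rwa [show n + d + m = n + m + d by ring] at this
    · have := SetLike.mul_mem_graded hh hg
      rwa [show n + (m + d) = n + m + d by ring] at this
  · have := algebraMap_ne_zero h0
    have := algebraMap_ne_zero k0
    simp only [map_add, map_mul]
    field_simp

theorem IsHomogeneousFraction.neg {d : ℕ} {x : FractionRing R}
    (hx : IsHomogeneousFraction 𝒜 d x) : IsHomogeneousFraction 𝒜 d (-x) := by
  obtain ⟨n, f, h, hf, hh, h0, rfl⟩ := hx
  exact ⟨n, -f, h, neg_mem hf, hh, h0, by rw [map_neg, neg_div]⟩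

theorem IsHomogeneousFraction.sub {d : ℕ} {x y : FractionRing R} [SetLike.GradedMonoid 𝒜]
    (hx : IsHomogeneousFraction 𝒜 d x) (hy : IsHomogeneousFraction 𝒜 d y) :
    IsHomogeneousFraction 𝒜 d (x - y) := by
  rw [sub_eq_add_neg]
  exact hx.add hy.neg

theorem IsHomogeneousFraction.mul {d e : ℕ} {x y : FractionRing R} [SetLike.GradedMonoid 𝒜]
    (hx : IsHomogeneousFraction 𝒜 d x) (hy : IsHomogeneousFraction 𝒜 e y) :
    IsHomogeneousFraction 𝒜 (d + e) (x * y) := by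
  obtain ⟨n, f, h, hf, hh, h0, rfl⟩ := hx
  obtain ⟨m, g, k, hg, hk, k0, rfl⟩ := hy
  refine ⟨n + m, f * g, h * k, ?_, SetLike.mul_mem_graded hh hk, mul_ne_zero h0 k0, ?_⟩
  · have := SetLike.mul_mem_graded hf hg
    rwa [show n + d + (m + e) = n + m + (d + e) by ring] at this
  · rw [map_mul, map_mul, div_mul_div_comm]

theorem IsHomogeneousFraction.div {d e : ℕ} {x y : FractionRing R} [SetLike.GradedMonoid 𝒜]
    (hx : IsHomogeneousFraction 𝒜 (d + e) x) (hy : IsHomogeneousFraction 𝒜 e y) (y0 : y ≠ 0) :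
    IsHomogeneousFraction 𝒜 d (x / y) := by
  obtain ⟨n, f, h, hf, hh, h0, rfl⟩ := hx
  obtain ⟨m, g, k, hg, hk, k0, rfl⟩ := hy
  have g0 : g ≠ 0 := by
    rintro rfl
    simp at y0
  refine ⟨n + (m + e), f * k, h * g, ?_, SetLike.mul_mem_graded hh hg, mul_ne_zero h0 g0, ?_⟩
  · have := SetLike.mul_mem_graded hf hk
    rwa [show n + (d + e) + m = n + (m + e) + d by ring] at this
  · rw [map_mul, map_mul, div_div_div_eq]

theorem exists_represents_some [SetLike.GradedMonoid 𝒜] {a b : R} {x y : FractionRing R}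
    (hxy : (genericCurve a b).Nonsingular x y) :
    (∃ f g h, Represents 𝒜 a b (.some x y hxy) f g h) ↔
      IsHomogeneousFraction 𝒜 2 x ∧ IsHomogeneousFraction 𝒜 3 y := by
  constructor
  · rintro ⟨f, g, h, ⟨⟨n, hf, hg, hh⟩, -, -⟩, h0, hx, hy⟩
    have p2 := SetLike.pow_mem_graded 2 hh
    have p3 := SetLike.pow_mem_graded 3 hh
    exact ⟨⟨2 * n, f, h ^ 2, hf, by simpa using p2, pow_ne_zero 2 h0, by rw [hx, map_pow]⟩,
      ⟨3 * n, g, h ^ 3, hg, by simpa using p3, pow_ne_zero 3 h0, by rw [hy, map_pow]⟩⟩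
  · rintro ⟨⟨n, f, h, hf, hh, h0, hx⟩, ⟨m, g, k, hg, hk, k0, hy⟩⟩
    have h0' := algebraMap_ne_zero h0
    have k0' := algebraMap_ne_zero k0
    have hX : x = algebraMap R (FractionRing R) (f * k * (h * k)) /
        algebraMap R (FractionRing R) (h * k) ^ 2 := by
      rw [hx]; simp only [map_mul]; field_simp
    have hY : y = algebraMap R (FractionRing R) (g * h * (h * k) ^ 2) /
        algebraMap R (FractionRing R) (h * k) ^ 3 := by
      rw [hy]; simp only [map_mul, map_pow]; field_simp
    have hkm := SetLike.mul_mem_graded hh hk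
    have hne : h * k ≠ 0 := mul_ne_zero h0 k0
    refine ⟨f * k * (h * k), g * h * (h * k) ^ 2, h * k,
      ⟨⟨n + m, ?_, ?_, hkm⟩, fun e => hne e.2.2, ?_⟩, hne, hX, hY⟩
    · have := SetLike.mul_mem_graded (SetLike.mul_mem_graded hf hk) hkm
      rwa [show n + 2 + m + (n + m) = 2 * (n + m) + 2 by ring] at this
    · have := SetLike.mul_mem_graded (SetLike.mul_mem_graded hg hh)
        (SetLike.pow_mem_graded 2 hkm)
      rwa [show m + 3 + n + 2 • (n + m) = 3 * (n + m) + 3 by simp; ring] at this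
    · have e := ((genericCurve a b).equation_iff x y).1 hxy.1
      simp only [genericCurve, zero_mul, add_zero] at e
      apply IsFractionRing.injective R (FractionRing R)
      have hne' := algebraMap_ne_zero hne
      generalize f * k * (h * k) = F at *
      generalize g * h * (h * k) ^ 2 = G at *
      generalize h * k = H at *
      rw [hX, hY] at e
      simp only [map_add, map_mul, map_pow]
      field_simp at e
      linear_combination e

variable (𝒜)

/-- The Mordell-Weil group: the points of the generic curve that come from a rational section
`z ↦ [f(z) : g(z) : h(z) z]`, with the group law of the generic curve (that is, fibrewise
addition of sections). -/
def mordellWeil [SetLike.GradedMonoid 𝒜] {a b : R} (ha : a ∈ 𝒜 4) (_hb : b ∈ 𝒜 6)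
    (h1 : ∃ t ∈ 𝒜 1, t ≠ 0) : AddSubgroup (genericCurve a b).Point where
  carrier := {P | ∃ f g h, Represents 𝒜 a b P f g h}
  zero_mem' := by
    obtain ⟨t, ht, t0⟩ := h1
    refine ⟨t ^ 2, t ^ 3, 0, ⟨⟨0, ?_, ?_, zero_mem _⟩,
      fun e => t0 ((pow_eq_zero_iff two_ne_zero).1 e.1), by ring⟩, rfl⟩
    · simpa using SetLike.pow_mem_graded 2 ht
    · simpa using SetLike.pow_mem_graded 3 ht
  neg_mem' := by
    rintro (_ | ⟨x, y, hxy⟩) hP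
    · exact hP
    · obtain ⟨hx, hy⟩ := (exists_represents_some hxy).1 hP
      refine (exists_represents_some _).2 ⟨hx, ?_⟩
      simpa [WeierstrassCurve.Affine.negY, genericCurve] using hy.neg
  add_mem' := by
    rintro (_ | ⟨x₁, y₁, h₁⟩) (_ | ⟨x₂, y₂, h₂⟩) hP hQ
    · exact hP
    · exact hQ
    · exact hP
    · by_cases hz : x₁ = x₂ ∧ y₁ = (genericCurve a b).negY x₂ y₂
      · rw [WeierstrassCurve.Affine.Point.add_of_Y_eq hz.1 hz.2]
        obtain ⟨t, ht, t0⟩ := h1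
        refine ⟨t ^ 2, t ^ 3, 0, ⟨⟨0, ?_, ?_, zero_mem _⟩,
      fun e => t0 ((pow_eq_zero_iff two_ne_zero).1 e.1), by ring⟩, rfl⟩
        · simpa using SetLike.pow_mem_graded 2 ht
        · simpa using SetLike.pow_mem_graded 3 ht
      · rw [WeierstrassCurve.Affine.Point.add_some hz]
        obtain ⟨hx₁, hy₁⟩ := (exists_represents_some h₁).1 hP
        obtain ⟨hx₂, hy₂⟩ := (exists_represents_some h₂).1 hQ
        have hs : IsHomogeneousFraction 𝒜 1 ((genericCurve a b).slope x₁ x₂ y₁ y₂) := by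
          by_cases hx : x₁ = x₂
          · have hy : y₁ ≠ (genericCurve a b).negY x₂ y₂ := fun h => hz ⟨hx, h⟩
            rw [WeierstrassCurve.Affine.slope_of_Y_ne hx hy]
            have hyy : y₁ = y₂ := WeierstrassCurve.Affine.Y_eq_of_Y_ne h₁.1 h₂.1 hx hy
            have hden : y₁ - (genericCurve a b).negY x₁ y₁ = y₁ + y₁ := by
              simp [WeierstrassCurve.Affine.negY, genericCurve]
            have hnum : 3 * x₁ ^ 2 + 2 * (genericCurve a b).a₂ * x₁ + (genericCurve a b).a₄ -
                (genericCurve a b).a₁ * y₁ =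
                x₁ * x₁ + x₁ * x₁ + x₁ * x₁ + algebraMap R (FractionRing R) a := by
              simp [genericCurve]; ring
            rw [hden, hnum]
            refine IsHomogeneousFraction.div (e := 3) ?_ (hy₁.add hy₁) ?_
            · have h4 : IsHomogeneousFraction 𝒜 4 (x₁ * x₁) := hx₁.mul hx₁
              exact ((h4.add h4).add h4).add (.of_mem ha)
            · rw [← hden]
              refine sub_ne_zero.2 ?_
              rw [← hx, ← hyy] at hy
              exact hy
          · rw [WeierstrassCurve.Affine.slope_of_X_ne hx]
            exact IsHomogeneousFraction.div (e := 2) (hy₁.sub hy₂) (hx₁.sub hx₂) (sub_ne_zero.2 hx)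
        have hX : IsHomogeneousFraction 𝒜 2 ((genericCurve a b).addX x₁ x₂
            ((genericCurve a b).slope x₁ x₂ y₁ y₂)) := by
          have h2 : IsHomogeneousFraction 𝒜 2 _ := hs.mul hs
          have := (h2.sub hx₁).sub hx₂
          simpa [WeierstrassCurve.Affine.addX, genericCurve, sq] using this
        refine (exists_represents_some _).2 ⟨hX, ?_⟩
        have h3 : IsHomogeneousFraction 𝒜 3 _ := hs.mul (hX.sub hx₁)
        have := (h3.add hy₁).neg
        simpa [WeierstrassCurve.Affine.addY, WeierstrassCurve.Affine.negAddY,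
          WeierstrassCurve.Affine.negY, genericCurve] using this

end Sections

/-! ### Lines in the projective plane -/

/-- The line `{a₀ z₀ + a₁ z₁ + a₂ z₂ = 0}` in the projective plane. -/
structure Line where
  coeff : Fin 3 → ℂ
  coeff_ne_zero : coeff ≠ 0

/-- The linear form that defines a line. -/
def Line.form (ℓ : Line) : MvPolynomial (Fin 3) ℂ := ∑ i, C (ℓ.coeff i) * X i

/-- The homogeneous coordinate ring of a line. -/
abbrev Line.coordRing (ℓ : Line) : Type :=
  MvPolynomial (Fin 3) ℂ ⧸ Ideal.span {ℓ.form}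

/-- Restriction of polynomials to a line. -/
abbrev Line.restrict (ℓ : Line) : MvPolynomial (Fin 3) ℂ →ₐ[ℂ] ℓ.coordRing :=
  Ideal.Quotient.mkₐ ℂ (Ideal.span {ℓ.form})

/-- The homogeneous elements of degree `n` of the coordinate ring of a line. -/
def Line.grading (ℓ : Line) (n : ℕ) : Submodule ℂ ℓ.coordRing :=
  (homogeneousSubmodule (Fin 3) ℂ n).map ℓ.restrict.toLinearMap

theorem Line.form_ne_zero (ℓ : Line) : ℓ.form ≠ 0 := by
  intro h
  apply ℓ.coeff_ne_zero
  funext i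
  have := congrArg (eval (Pi.single i (1 : ℂ))) h
  simpa [Line.form, Pi.single_apply] using this

theorem Line.form_isHomogeneous (ℓ : Line) : ℓ.form.IsHomogeneous 1 := by
  refine IsHomogeneous.sum _ _ _ fun i _ => ?_
  simpa using (isHomogeneous_C (Fin 3) (ℓ.coeff i)).mul (isHomogeneous_X ℂ i)

theorem Line.form_irreducible (ℓ : Line) : Irreducible ℓ.form := by
  have hd := ℓ.form_isHomogeneous.totalDegree ℓ.form_ne_zero
  refine irreducible_of_totalDegree_eq_one hd fun x hx => ?_
  have hx0 : x ≠ 0 := by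
    rintro rfl
    exact ℓ.form_ne_zero (by ext m; simpa using hx m)
  exact hx0.isUnit

instance (ℓ : Line) : (Ideal.span {ℓ.form}).IsPrime :=
  (Ideal.span_singleton_prime ℓ.form_ne_zero).2 ℓ.form_irreducible.prime

instance (ℓ : Line) : IsDomain ℓ.coordRing := Ideal.Quotient.isDomain _

instance (ℓ : Line) : SetLike.GradedMonoid ℓ.grading where
  one_mem := ⟨1, isHomogeneous_one _ _, map_one ℓ.restrict⟩
  mul_mem := by
    rintro i j _ _ ⟨f, hf, rfl⟩ ⟨g, hg, rfl⟩
    exact ⟨f * g, IsHomogeneous.mul hf hg, map_mul ℓ.restrict f g⟩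

theorem Line.restrict_mem (ℓ : Line) {n : ℕ} {f : MvPolynomial (Fin 3) ℂ}
    (hf : f.IsHomogeneous n) : ℓ.restrict f ∈ ℓ.grading n :=
  ⟨f, hf, rfl⟩

theorem Line.exists_ne_zero (ℓ : Line) : ∃ t ∈ ℓ.grading 1, t ≠ 0 := by
  by_contra! hcon
  have hX : ∀ (i : Fin 3) (v : Fin 3 → ℂ), eval v ℓ.form = 0 → v i = 0 := by
    intro i v hv
    have h0 := hcon _ (ℓ.restrict_mem (isHomogeneous_X ℂ i))
    obtain ⟨u, hu⟩ := Ideal.mem_span_singleton.1 (Ideal.Quotient.eq_zero_iff_mem.1 h0)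
    have := congrArg (eval v) hu
    simpa [hv] using this
  apply ℓ.coeff_ne_zero
  have e : ∀ v : Fin 3 → ℂ, eval v ℓ.form =
      ℓ.coeff 0 * v 0 + ℓ.coeff 1 * v 1 + ℓ.coeff 2 * v 2 := by
    intro v; simp [Line.form, Fin.sum_univ_three]
  have h0 := hX 1 ![ℓ.coeff 1, -ℓ.coeff 0, 0] (by rw [e]; simp; ring)
  have h1 := hX 0 ![ℓ.coeff 1, -ℓ.coeff 0, 0] (by rw [e]; simp; ring)
  have h2 := hX 0 ![ℓ.coeff 2, 0, -ℓ.coeff 0] (by rw [e]; simp; ring)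
  have h0' : ℓ.coeff 0 = 0 := by simpa using h0
  have h1' : ℓ.coeff 1 = 0 := by simpa using h1
  have h2' : ℓ.coeff 2 = 0 := by simpa using h2
  funext i
  fin_cases i <;> simp [h0', h1', h2']

/-- A property holds for a very general line: for all lines outside a countable union of proper
closed subsets of the dual projective plane. -/
def ForVeryGeneralLine (p : Line → Prop) : Prop :=
  ∃ G : ℕ → MvPolynomial (Fin 3) ℂ,
    (∀ i, G i ≠ 0 ∧ ∃ d, (G i).IsHomogeneous d) ∧
    ∀ ℓ : Line, (∀ i, eval ℓ.coeff (G i) ≠ 0) → p ℓ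

/-! ### Plane curves -/

/-- An equation of the reduced curve underlying `F = 0`: the product of the distinct irreducible
factors of `F`. -/
def reducedEquation (F : MvPolynomial (Fin 3) ℂ) : MvPolynomial (Fin 3) ℂ :=
  letI := UniqueFactorizationMonoid.strongNormalizationMonoid (α := MvPolynomial (Fin 3) ℂ)
  UniqueFactorizationMonoid.radical F

/-- Every irreducible component of the curve `D = 0` is a line. -/
def IsUnionOfLines (D : MvPolynomial (Fin 3) ℂ) : Prop :=
  ∀ p : MvPolynomial (Fin 3) ℂ, Irreducible p → p ∣ D → p.IsHomogeneous 1

/-- `D = 0` is an irreducible conic. -/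
def IsIrreducibleConic (D : MvPolynomial (Fin 3) ℂ) : Prop :=
  Irreducible D ∧ D.IsHomogeneous 2

/-- The line `ℓ` is tangent to the curve `D = 0` (`D` a reduced equation): at some smooth point `v`
of the curve, `ℓ` is the tangent line `∑ i, (∂D/∂zᵢ)(v) zᵢ = 0`. -/
def Line.IsTangentTo (ℓ : Line) (D : MvPolynomial (Fin 3) ℂ) : Prop :=
  ∃ v : Fin 3 → ℂ, v ≠ 0 ∧ eval v D = 0 ∧
    ∃ c : ℂ, c ≠ 0 ∧ ∀ i, eval v (pderiv i D) = c * ℓ.coeff i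

/-- The line `ℓ` and the curve `D = 0` have at least two distinct points in common
(linearly independent vectors represent distinct points of the projective plane). -/
def Line.MeetsInTwoPoints (ℓ : Line) (D : MvPolynomial (Fin 3) ℂ) : Prop :=
  ∃ v w : Fin 3 → ℂ, LinearIndependent ℂ ![v, w] ∧
    (eval v ℓ.form = 0 ∧ eval v D = 0) ∧ (eval w ℓ.form = 0 ∧ eval w D = 0)

/-! ### Elliptic threefolds -/

/-- An elliptic threefold `π : Y → ℙ²`, where `Y` is the hypersurface `y² = x³ + A x + B` of
degree `6` in `ℙ(2, 3, 1, 1, 1)`. -/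
structure EllipticThreefold where
  A : MvPolynomial (Fin 3) ℂ
  B : MvPolynomial (Fin 3) ℂ
  homogeneous_A : A.IsHomogeneous 4
  homogeneous_B : B.IsHomogeneous 6
  disc_ne_zero : 4 * A ^ 3 + 27 * B ^ 2 ≠ 0

namespace EllipticThreefold

variable (Y : EllipticThreefold)

/-- The discriminant. -/
def disc : MvPolynomial (Fin 3) ℂ := 4 * Y.A ^ 3 + 27 * Y.B ^ 2

/-- An equation of the reduced discriminant curve. -/
def reducedDisc : MvPolynomial (Fin 3) ℂ := reducedEquation Y.disc

/-- The Mordell-Weil group of `π : Y → ℙ²`. -/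
def MW : AddSubgroup (genericCurve Y.A Y.B).Point :=
  mordellWeil (homogeneousSubmodule (Fin 3) ℂ)
    ((mem_homogeneousSubmodule 4 Y.A).2 Y.homogeneous_A)
    ((mem_homogeneousSubmodule 6 Y.B).2 Y.homogeneous_B)
    ⟨X 0, (mem_homogeneousSubmodule 1 _).2 (isHomogeneous_X ℂ 0), X_ne_zero 0⟩

/-- The Mordell-Weil group of `π_ℓ : Y_ℓ → ℓ`, where `Y_ℓ` is the part of `Y` over the line `ℓ`. -/
def MWLine (ℓ : Line) : AddSubgroup (genericCurve (ℓ.restrict Y.A) (ℓ.restrict Y.B)).Point :=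
  mordellWeil ℓ.grading (ℓ.restrict_mem Y.homogeneous_A) (ℓ.restrict_mem Y.homogeneous_B)
    ℓ.exists_ne_zero

/-- `τ` is the restriction to `ℓ` of the rational section `σ`: polynomials `f, g, h` that
represent `σ` and do not all vanish on `ℓ` represent `τ` when restricted to `ℓ`. -/
def IsRestriction (ℓ : Line) (σ : Y.MW) (τ : Y.MWLine ℓ) : Prop :=
  ∃ f g h : MvPolynomial (Fin 3) ℂ,
    Represents (homogeneousSubmodule (Fin 3) ℂ) Y.A Y.B σ.1 f g h ∧
    Represents ℓ.grading (ℓ.restrict Y.A) (ℓ.restrict Y.B) τ.1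
      (ℓ.restrict f) (ℓ.restrict g) (ℓ.restrict h)

/-- A rational section has at most one restriction to a given line. -/
theorem IsRestriction.unique {Y : EllipticThreefold} {ℓ : Line} {σ : Y.MW} {τ τ' : Y.MWLine ℓ}
    (h₁ : Y.IsRestriction ℓ σ τ) (h₂ : Y.IsRestriction ℓ σ τ') : τ = τ' := by
  obtain ⟨⟨_ | ⟨x, y, hxy⟩⟩, hσ⟩ := σ <;> obtain ⟨⟨_ | ⟨u, v, huv⟩⟩, hτ⟩ := τ <;>
    obtain ⟨⟨_ | ⟨u', v', huv'⟩⟩, hτ'⟩ := τ' <;>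
    obtain ⟨f, g, h, ⟨-, hs⟩, ⟨T, ht⟩⟩ := h₁ <;>
    obtain ⟨f', g', h', ⟨-, hs'⟩, ⟨T', ht'⟩⟩ := h₂
  · rfl
  · exact absurd (by rw [show h' = 0 from hs', map_zero]) ht'.1
  · exact absurd (by rw [show h = 0 from hs, map_zero]) ht.1
  · exact absurd (by rw [show h = 0 from hs, map_zero]) ht.1
  · rfl
  all_goals
    obtain ⟨h0, rfl, rfl⟩ := hs
    obtain ⟨h0', e2, e3⟩ := hs'
    have i0 := algebraMap_ne_zero h0
    have i0' := algebraMap_ne_zero h0'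
    rw [div_eq_div_iff (pow_ne_zero _ i0) (pow_ne_zero _ i0'), ← map_pow, ← map_pow, ← map_mul,
      ← map_mul] at e2 e3
    have r2 := congrArg ℓ.restrict (IsFractionRing.injective _ _ e2)
    have r3 := congrArg ℓ.restrict (IsFractionRing.injective _ _ e3)
    simp only [map_mul, map_pow] at r2 r3
  · refine absurd ⟨?_, ?_, ht⟩ T.ne_zero
    · rw [show ℓ.restrict h = 0 from ht, zero_pow two_ne_zero, mul_zero] at r2
      exact (mul_eq_zero.1 r2).resolve_right (pow_ne_zero 2 ht'.1)
    · rw [show ℓ.restrict h = 0 from ht, zero_pow three_ne_zero, mul_zero] at r3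
      exact (mul_eq_zero.1 r3).resolve_right (pow_ne_zero 3 ht'.1)
  · refine absurd ⟨?_, ?_, ht'⟩ T'.ne_zero
    · rw [show ℓ.restrict h' = 0 from ht', zero_pow two_ne_zero, mul_zero] at r2
      exact (mul_eq_zero.1 r2.symm).resolve_right (pow_ne_zero 2 ht.1)
    · rw [show ℓ.restrict h' = 0 from ht', zero_pow three_ne_zero, mul_zero] at r3
      exact (mul_eq_zero.1 r3.symm).resolve_right (pow_ne_zero 3 ht.1)
  · obtain ⟨t0, rfl, rfl⟩ := ht
    obtain ⟨t0', rfl, rfl⟩ := ht'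
    have k0 := algebraMap_ne_zero t0
    have k0' := algebraMap_ne_zero t0'
    congr 2
    · rw [div_eq_div_iff (pow_ne_zero _ k0) (pow_ne_zero _ k0')]
      have s2 := congrArg (algebraMap ℓ.coordRing (FractionRing ℓ.coordRing)) r2
      rwa [RingHom.map_mul, RingHom.map_mul, RingHom.map_pow, RingHom.map_pow] at s2
    · rw [div_eq_div_iff (pow_ne_zero _ k0) (pow_ne_zero _ k0')]
      have s3 := congrArg (algebraMap ℓ.coordRing (FractionRing ℓ.coordRing)) r3
      rwa [RingHom.map_mul, RingHom.map_mul, RingHom.map_pow, RingHom.map_pow] at s3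

/-- The line `ℓ` is not a component of the discriminant curve (so that `π_ℓ` is an elliptic
surface), every section in `MW(π)` has a restriction to `ℓ`, and restriction of sections is an
injective group homomorphism from `MW(π)` to `MW(π_ℓ)`. -/
def RestrictionInjective (ℓ : Line) : Prop :=
  ¬ ℓ.form ∣ Y.disc ∧
    ∃ φ : Y.MW →+ Y.MWLine ℓ, (∀ σ, Y.IsRestriction ℓ σ (φ σ)) ∧ Function.Injective φ

end EllipticThreefold

end EllThreefold

end

open EllThreefold

/-!
The theorem rests on derivations `d` of the field `ℂ`. Extend `d` to a derivation `D` of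
`ℂ[z₀, z₁, z₂]` that acts on coefficients, and assume that `d` kills the coefficients of `A` and
`B`, so that `D A = D B = 0`.

**Injectivity.** Restriction of sections to a line `ℓ` that is not in the discriminant curve is
reduction of the points of the generic fibre at the place of `ℂ(z₀, z₁, z₂)` at `ℓ`; it is additive
because `ℓ` is a place of good reduction (`Reduces.add`). A section in the kernel is a point
`x = f / h²`, `y = g / h³` that has a pole along `ℓ`. The expression `D x / y`, which is the
invariant differential contracted with `D`, has no poles if the Weierstrass equation is minimal
(`dvd_mul_derivation_sub`). It is homogeneous of degree `-1`, so it is zero and `D x = 0`. But then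
`D` preserves the polar divisor of `x`, so `ℓ` divides `D ℓ`. If the equation is not minimal, then
the generic fibre is isomorphic to a constant curve, and the same argument works with the partial
derivatives in place of `D`. In short, restriction is well defined and injective for every line that
is not preserved by `D` (`restrictionInjective_of_derivation`). By the extension theorem
for derivations in characteristic zero, every line outside countably many pencils moves under some
such `d` (`exists_countable_forall_derivation_line`), which gives the first part.

**Tangent lines.** Since `D` kills the discriminant, it preserves the reduced discriminant
`q`, that is, `D q = c q`. Suppose that a component of `q = 0` is not a line. The tangent line at a
suitable point `v` of this component (`exists_generic_tangent`) moves under some `d`. Let `u = d v`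
be the velocity of the point and `w` the gradient of `q` at `v`. Differentiating `q(v) = 0` gives
`u · w = 0`, so `u` lies on the tangent line; and `u` is not a multiple of `v`, for otherwise `d w`
would be a multiple of `w`. If the tangent line had no point in common with the curve other than
`v`, then, as `q` has degree at least `3`, the Hessian of `q` at `v` would vanish on `u`, and both
`v` and `u` would be orthogonal to `w` and to `d w`, hence parallel
(`exists_eval_eq_zero_on_tangent`).
-/

noncomputable section

namespace EllThreefold

open MvPolynomial

/-! ### Derivations of fields of characteristic zero -/

open scoped IntermediateField.algebraAdjoinAdjoin in
/-- A field of characteristic zero is formally étale over the polynomial ring in the elements of a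
transcendence basis: it is a separable algebraic extension of a localization of that ring. -/
theorem formallyEtale_of_isTranscendenceBasis {k L ι : Type*} [Field k] [Field L] [Algebra k L]
    [CharZero k] {v : ι → L} (hv : IsTranscendenceBasis k v)
    [Algebra (MvPolynomial ι k) L] (ha : ∀ p, algebraMap (MvPolynomial ι k) L p = aeval v p) :
    Algebra.FormallyEtale (MvPolynomial ι k) L := by
  let e := hv.1.aevalEquiv
  have he : ∀ p, (e p : L) = aeval v p := hv.1.algebraMap_aevalEquiv
  let : Algebra (MvPolynomial ι k) (Algebra.adjoin k (Set.range v)) := e.toRingHom.toAlgebra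
  have : IsScalarTower (MvPolynomial ι k) (Algebra.adjoin k (Set.range v)) L :=
    .of_algebraMap_eq fun p => by rw [ha, ← he]; rfl
  have : Algebra.FormallyEtale (MvPolynomial ι k) (Algebra.adjoin k (Set.range v)) :=
    .of_equiv (AlgEquiv.ofRingEquiv (f := e.toRingEquiv) fun _ => rfl)
  have : Algebra.FormallyEtale (Algebra.adjoin k (Set.range v))
      (IntermediateField.adjoin k (Set.range v)) := .of_isLocalization (nonZeroDivisors _)
  have : Algebra.IsAlgebraic (IntermediateField.adjoin k (Set.range v)) L := hv.isAlgebraic_field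
  have : Algebra.FormallyEtale (IntermediateField.adjoin k (Set.range v)) L :=
    Algebra.FormallyEtale.of_isSeparable _ L
  have : Algebra.FormallyEtale (Algebra.adjoin k (Set.range v)) L :=
    .comp _ (IntermediateField.adjoin k (Set.range v)) _
  exact .comp _ (Algebra.adjoin k (Set.range v)) _

/-- An element that is transcendental over a field of characteristic zero is not a constant for
all derivations over that field: it belongs to a transcendence basis, and the partial derivative
with respect to it extends from the polynomial ring over which the field is formally étale. -/
theorem exists_derivation_apply_ne_zero {k L : Type*} [Field k] [Field L] [Algebra k L]
    [CharZero k] {t : L} (ht : Transcendental k t) : ∃ d : Derivation k L L, d t ≠ 0 := by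
  have hi : AlgebraicIndepOn k id ({t} : Set L) := by
    have : AlgebraicIndependent k (fun _ : ({t} : Set L) => t) :=
      algebraicIndependent_unique_type_iff.2 ht
    convert! this using 1
    funext x
    exact x.2
  obtain ⟨s, hs, hb⟩ := exists_isTranscendenceBasis_superset hi
  let : Algebra (MvPolynomial s k) L := (aeval (Subtype.val : s → L)).toRingHom.toAlgebra
  have ha : ∀ p, algebraMap (MvPolynomial s k) L p = aeval (Subtype.val : s → L) p := fun _ => rfl
  have : IsScalarTower k (MvPolynomial s k) L :=
    .of_algebraMap_eq fun c => by rw [ha, MvPolynomial.algebraMap_eq, aeval_C]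
  have := formallyEtale_of_isTranscendenceBasis hb ha
  let i : s := ⟨t, hs rfl⟩
  classical
  let δ : Derivation k (MvPolynomial s k) L := mkDerivation k (Pi.single i 1)
  let φ : Ω[L⁄k] →ₗ[L] L := (LinearMap.liftBaseChange L δ.liftKaehlerDifferential).comp
    (KaehlerDifferential.tensorKaehlerEquivOfFormallyEtale k (MvPolynomial s k) L).symm.toLinearMap
  refine ⟨φ.compDer (KaehlerDifferential.D k L), ?_⟩
  have hX : algebraMap (MvPolynomial s k) L (X i) = t := by rw [ha, aeval_X]
  have : φ (KaehlerDifferential.D k L t) = 1 := by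
    rw [← hX]
    simp only [φ, LinearMap.comp_apply, LinearEquiv.coe_coe,
      KaehlerDifferential.tensorKaehlerEquivOfFormallyEtale_symm_D_algebraMap,
      LinearMap.liftBaseChange_tmul, Derivation.liftKaehlerDifferential_comp_D, δ,
      mkDerivation_X, Pi.single_eq_same, one_smul]
  simp [this]

/-- The elements of a field of characteristic zero that are constants for all derivations killing
a given countable set lie in the algebraic closure of a countable subfield. -/
theorem exists_countable_forall_derivation {L : Type*} [Field L] [CharZero L] {S : Set L}
    (hS : S.Countable) : ∃ F : Set L, F.Countable ∧
      ∀ t ∉ F, ∃ d : Derivation ℤ L L, (∀ s ∈ S, d s = 0) ∧ d t ≠ 0 := by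
  let k := Subfield.closure S
  have : Countable k := by
    rw [← Cardinal.mk_le_aleph0_iff]
    refine (Subfield.cardinalMk_closure_le_max S).trans ?_
    simpa using hS
  refine ⟨{x | IsAlgebraic k x}, Algebraic.countable k L, fun t ht => ?_⟩
  obtain ⟨d, hd⟩ := exists_derivation_apply_ne_zero (k := k) (t := t) ht
  refine ⟨d.restrictScalars ℤ, fun s hs => ?_, hd⟩
  exact d.map_algebraMap (⟨s, Subfield.subset_closure hs⟩ : k)

/-! ### Derivations of polynomial rings and homogeneous polynomials -/

section CoeffDerivation

variable {σ A : Type*} [CommRing A]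

/-- The polynomial obtained by applying an additive map to each coefficient. -/
def mapCoeff (d : A →+ A) : MvPolynomial σ A →+ MvPolynomial σ A where
  toFun f := AddMonoidAlgebra.ofCoeff (Finsupp.mapRange d (map_zero d) (AddMonoidAlgebra.coeff f))
  map_zero' := by ext; exact map_zero d
  map_add' f g := by ext m; exact map_add d (coeff m f) (coeff m g)

/-- The derivation of a polynomial ring that applies a derivation to each coefficient. -/
def coeffDerivation (d : Derivation ℤ A A) :
    Derivation ℤ (MvPolynomial σ A) (MvPolynomial σ A) :=
  Derivation.mk' (mapCoeff d.toLinearMap.toAddMonoidHom).toIntLinearMap (by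
    have key : ∀ (f : MvPolynomial σ A) m,
        coeff m (mapCoeff d.toLinearMap.toAddMonoidHom f) = d (coeff m f) := fun _ _ => rfl
    intro f g
    ext m
    classical
    change coeff m (mapCoeff d.toLinearMap.toAddMonoidHom (f * g)) =
      coeff m (f * mapCoeff d.toLinearMap.toAddMonoidHom g +
        g * mapCoeff d.toLinearMap.toAddMonoidHom f)
    rw [mul_comm g]
    simp only [coeff_add, coeff_mul, key, map_sum, Derivation.leibniz, smul_eq_mul,
      Finset.sum_add_distrib]
    simp only [mul_comm])

variable (d : Derivation ℤ A A)

@[simp]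
theorem coeff_coeffDerivation (f : MvPolynomial σ A) (m : σ →₀ ℕ) :
    coeff m (coeffDerivation d f) = d (coeff m f) := rfl

@[simp]
theorem coeffDerivation_C (a : A) : coeffDerivation d (C a : MvPolynomial σ A) = C (d a) := by
  classical
  ext m
  simp only [coeff_coeffDerivation, coeff_C]
  split_ifs <;> simp

@[simp]
theorem coeffDerivation_X (i : σ) : coeffDerivation d (X i : MvPolynomial σ A) = 0 := by
  classical
  ext m
  simp only [coeff_coeffDerivation, coeff_X, coeff_zero]
  split_ifs <;> simp

theorem totalDegree_coeffDerivation_le (f : MvPolynomial σ A) :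
    (coeffDerivation d f).totalDegree ≤ f.totalDegree := by
  refine Finset.sup_mono fun m hm => ?_
  rw [mem_support_iff] at hm ⊢
  intro h
  simp [h] at hm

theorem coeffDerivation_eq_zero {f : MvPolynomial σ A} (hf : ∀ m, d (coeff m f) = 0) :
    coeffDerivation d f = 0 := by
  ext m
  simp [hf]

theorem coeffDerivation_pderiv (i : σ) (f : MvPolynomial σ A) :
    coeffDerivation d (pderiv i f) = pderiv i (coeffDerivation d f) := by
  ext m
  simp [coeff_pderiv, mul_comm]

/-- The chain rule for evaluation at a point with nonconstant coordinates. -/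
theorem derivation_eval [Fintype σ] (f : MvPolynomial σ A) (v : σ → A) :
    d (eval v f) = eval v (coeffDerivation d f) + ∑ i, eval v (pderiv i f) * d (v i) := by
  classical
  induction f using MvPolynomial.induction_on with
  | C a => simp
  | add f g hf hg => simp [hf, hg, add_mul, Finset.sum_add_distrib]; ring
  | mul_X f j hf =>
    simp only [map_mul, eval_X, Derivation.leibniz, hf, smul_eq_mul, coeffDerivation_X, map_add,
      pderiv_X, add_mul, Finset.sum_add_distrib, mul_add, Finset.mul_sum, map_zero, mul_zero]
    have : ∀ i, eval v f * eval v (Pi.single (M := fun _ => MvPolynomial σ A) i 1 j) * d (v i) =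
        if i = j then eval v f * d (v j) else 0 := by
      intro i
      by_cases h : i = j
      · subst h; simp
      · simp [h, Ne.symm h]
    simp only [this, Finset.sum_ite_eq', Finset.mem_univ, if_true, mul_assoc]
    ring

end CoeffDerivation

theorem totalDegree_pderiv_lt {σ R : Type*} [CommRing R] (i : σ) {f : MvPolynomial σ R}
    (hf : f.totalDegree ≠ 0) : (pderiv i f).totalDegree < f.totalDegree := by
  refine (Finset.sup_lt_iff (Nat.pos_of_ne_zero hf)).2 fun m hm => ?_
  have hm' : coeff (m + Finsupp.single i 1) f ≠ 0 := by
    intro h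
    rw [mem_support_iff, coeff_pderiv, h, zero_mul] at hm
    exact hm rfl
  have := le_totalDegree (mem_support_iff.2 hm')
  rw [Finsupp.sum_add_index' (fun _ => rfl) (fun _ _ _ => rfl),
    Finsupp.sum_single_index rfl] at this
  exact this

/-- A nonconstant polynomial has a nonzero partial derivative in characteristic zero. -/
theorem exists_pderiv_ne_zero {σ R : Type*} [CommRing R] [IsDomain R] [CharZero R]
    {f : MvPolynomial σ R} (hf : f.totalDegree ≠ 0) : ∃ i, pderiv i f ≠ 0 := by
  by_contra! h
  apply hf
  rw [totalDegree_eq_zero_iff]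
  intro m hm i
  by_contra hi
  have := congrArg (coeff (m - Finsupp.single i 1)) (h i)
  rw [coeff_pderiv, tsub_add_cancel_of_le (by simpa using Nat.one_le_iff_ne_zero.2 hi),
    coeff_zero, mul_eq_zero] at this
  rcases this with h1 | h1
  · exact mem_support_iff.1 hm h1
  · exact (Nat.cast_add_one_ne_zero _) h1

section Homogeneous

variable {σ R : Type*} [CommRing R]

/-- The homomorphism `f(z) ↦ f(t z)` to polynomials in `t`. -/
def scaleHom : MvPolynomial σ R →ₐ[R] Polynomial (MvPolynomial σ R) :=
  aeval fun i => Polynomial.C (X i) * Polynomial.X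

theorem coeff_scaleHom (f : MvPolynomial σ R) (n : ℕ) :
    (scaleHom f).coeff n = homogeneousComponent n f := by
  classical
  induction f using MvPolynomial.induction_on' with
  | monomial m a =>
    have h : scaleHom (monomial m a) =
        Polynomial.C (monomial m a) * Polynomial.X ^ (m.degree) := by
      rw [scaleHom, aeval_monomial, Finsupp.prod]
      simp only [mul_pow, Finset.prod_mul_distrib, Finset.prod_pow_eq_pow_sum]
      rw [monomial_eq, Finsupp.prod, Finsupp.degree_apply]
      simp only [IsScalarTower.algebraMap_apply R (MvPolynomial σ R)
        (Polynomial (MvPolynomial σ R)), algebraMap_eq, Polynomial.algebraMap_eq, map_mul, map_prod,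
        map_pow, mul_assoc]
    rw [h, Polynomial.coeff_C_mul_X_pow]
    rw [homogeneousComponent_of_mem (isHomogeneous_monomial a rfl)]
  | add f g hf hg => simp [hf, hg]

theorem scaleHom_of_isHomogeneous {f : MvPolynomial σ R} {n : ℕ} (hf : f.IsHomogeneous n) :
    scaleHom f = Polynomial.monomial n f := by
  ext1 k
  rw [coeff_scaleHom, Polynomial.coeff_monomial, homogeneousComponent_of_mem hf]
  simp [eq_comm]

theorem isHomogeneous_natDegree_of_natTrailingDegree_eq {f : MvPolynomial σ R}
    (h : (scaleHom f).natTrailingDegree = (scaleHom f).natDegree) :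
    f.IsHomogeneous (scaleHom f).natDegree := by
  have hz : ∀ n, n ≠ (scaleHom f).natDegree → homogeneousComponent n f = 0 := by
    intro n hn
    rw [← coeff_scaleHom]
    rcases lt_or_gt_of_ne hn with h1 | h1
    · exact Polynomial.coeff_eq_zero_of_lt_natTrailingDegree (h ▸ h1)
    · exact Polynomial.coeff_eq_zero_of_natDegree_lt h1
  intro m hm
  by_contra hne
  have := congrArg (coeff m) (hz m.degree (by rwa [Finsupp.degree_eq_weight_one]))
  rw [coeff_homogeneousComponent, if_pos rfl] at this
  exact hm this

/-- A factor of a nonzero homogeneous polynomial is homogeneous: if `f(t z) * k(t z)` is a monomial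
in `t`, then so is each factor. -/
theorem exists_isHomogeneous_of_dvd [IsDomain R] {f g : MvPolynomial σ R} {n : ℕ}
    (hg : g.IsHomogeneous n) (hg0 : g ≠ 0) (hfg : f ∣ g) : ∃ m, f.IsHomogeneous m := by
  obtain ⟨k, rfl⟩ := hfg
  have hinj : ∀ p : MvPolynomial σ R, p ≠ 0 → scaleHom p ≠ 0 := by
    intro p hp h
    apply hp
    rw [← sum_homogeneousComponent p]
    exact Finset.sum_eq_zero fun i _ => by rw [← coeff_scaleHom, h, Polynomial.coeff_zero]
  have h1 := hinj _ (left_ne_zero_of_mul hg0)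
  have h2 := hinj _ (right_ne_zero_of_mul hg0)
  have h := scaleHom_of_isHomogeneous hg
  rw [map_mul] at h
  have hd := congrArg Polynomial.natDegree h
  have ht := congrArg Polynomial.natTrailingDegree h
  rw [Polynomial.natDegree_mul h1 h2, Polynomial.natDegree_monomial_eq _ hg0] at hd
  rw [Polynomial.natTrailingDegree_mul h1 h2, Polynomial.natTrailingDegree_monomial hg0] at ht
  have l1 := Polynomial.natTrailingDegree_le_natDegree (scaleHom f)
  have l2 := Polynomial.natTrailingDegree_le_natDegree (scaleHom k)
  exact ⟨_, isHomogeneous_natDegree_of_natTrailingDegree_eq (by omega)⟩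

theorem isHomogeneous_right_of_mul [IsDomain R] {f g : MvPolynomial σ R} {m n : ℕ}
    (hf : f.IsHomogeneous m) (hf0 : f ≠ 0) (hfg : (f * g).IsHomogeneous (m + n)) :
    g.IsHomogeneous n := by
  by_cases hg0 : g = 0
  · exact hg0 ▸ isHomogeneous_zero _ _ _
  obtain ⟨k, hk⟩ := exists_isHomogeneous_of_dvd hfg (mul_ne_zero hf0 hg0) (dvd_mul_left g f)
  have := (hf.mul hk).inj_right hfg (mul_ne_zero hf0 hg0)
  rwa [show n = k by omega]

end Homogeneous

/-! ### Derivatives of sections of a minimal Weierstrass equation -/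

section Integrality

theorem isUnit_natCast_of_ne_zero {R : Type*} [CommRing R] [Algebra ℚ R] {n : ℕ} (hn : n ≠ 0) :
    IsUnit (n : R) := by
  have : IsUnit (n : ℚ) := (Nat.cast_ne_zero.2 hn).isUnit
  simpa using this.map (algebraMap ℚ R)

theorem not_prime_dvd_natCast {R : Type*} [CommRing R] [Algebra ℚ R] {p : R} (hp : Prime p)
    {n : ℕ} (hn : n ≠ 0) : ¬ p ∣ (n : R) :=
  fun h => hp.not_isUnit (isUnit_of_dvd_unit h (isUnit_natCast_of_ne_zero hn))

theorem prime_pow_dvd_of_dvd_mul_of_not_dvd {R : Type*} [CommRing R] [IsDomain R] {p x y : R}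
    (hp : Prime p) {a n : ℕ} (hx : p ^ (a + n) ∣ x * y) (hy : ¬ p ^ (n + 1) ∣ y) : p ^ a ∣ x := by
  induction n generalizing y with
  | zero =>
    rw [zero_add, pow_one] at hy
    exact hp.pow_dvd_of_dvd_mul_right _ hy hx
  | succ n ih =>
    by_cases h : p ∣ y
    · obtain ⟨z, rfl⟩ := h
      refine ih (y := z) ?_ fun hz => hy ?_
      · rw [← mul_dvd_mul_iff_left hp.ne_zero]
        convert hx using 1 <;> ring
      · rw [pow_succ']
        exact mul_dvd_mul_left p hz
    · exact (pow_dvd_pow p (by omega)).trans (hp.pow_dvd_of_dvd_mul_right _ h hx)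

variable {R : Type*} [CommRing R] (D : Derivation ℤ R R)

theorem pow_dvd_derivation_of_pow_dvd {p x : R} (hp : p ∣ D p) {n : ℕ} (h : p ^ n ∣ x) :
    p ^ n ∣ D x := by
  obtain ⟨y, rfl⟩ := h
  rw [D.leibniz, D.leibniz_pow, smul_eq_mul, smul_eq_mul, nsmul_eq_mul, smul_eq_mul]
  refine dvd_add (dvd_mul_right _ _) (Dvd.dvd.mul_left ?_ _)
  cases n with
  | zero => simp
  | succ n =>
    rw [Nat.add_sub_cancel, pow_succ]
    exact Dvd.dvd.mul_left (mul_dvd_mul_left _ hp) _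

/-- If `x` divides `c * D x`, where `p` is a prime factor of `x` that does not divide `c`, then `p`
divides `D p`: otherwise `D x` vanishes along `p` to a lower order than `x`. -/
theorem prime_dvd_derivation_self [IsDomain R] [Algebra ℚ R] [WfDvdMonoid R] {p x c : R}
    (hp : Prime p) (hx : x ≠ 0) (hpx : p ∣ x) (hpc : ¬ p ∣ c) (h : x ∣ c * D x) : p ∣ D p := by
  obtain ⟨n, y, hy, rfl⟩ := WfDvdMonoid.max_power_factor hx hp.irreducible
  have hn : n ≠ 0 := by
    rintro rfl
    rw [pow_zero, one_mul] at hpx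
    exact hy hpx
  obtain ⟨m, rfl⟩ := Nat.exists_eq_succ_of_ne_zero hn
  obtain ⟨u, hu⟩ := h
  rw [D.leibniz, D.leibniz_pow, smul_eq_mul, smul_eq_mul, nsmul_eq_mul, smul_eq_mul,
    Nat.succ_eq_add_one, Nat.add_sub_cancel] at hu
  have h1 : (((m + 1 : ℕ) : R) * (c * y)) * D p = p * (y * u - c * D y) := by
    apply mul_left_cancel₀ (pow_ne_zero m hp.ne_zero)
    linear_combination hu
  have h2 : p ∣ (((m + 1 : ℕ) : R) * (c * y)) * D p := ⟨_, h1⟩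
  rcases hp.dvd_or_dvd h2 with h3 | h3
  · rcases hp.dvd_or_dvd h3 with h4 | h4
    · exact absurd h4 (not_prime_dvd_natCast hp hn)
    · exact ((hp.dvd_or_dvd h4).elim hpc hy).elim
  · exact h3

variable {D} {A B f g h : R}

/-- A prime factor common to `f`, `g` and `h` can be removed from a solution of the weighted
homogeneous equation. -/
theorem sq_dvd_and_cube_dvd_of_equation [IsDomain R] {p : R} (hp : Prime p)
    (he : g ^ 2 = f ^ 3 + A * f * h ^ 4 + B * h ^ 6) (hg : p ∣ g) (hh : p ∣ h) :
    p ^ 2 ∣ f ∧ p ^ 3 ∣ g := by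
  obtain ⟨k, rfl⟩ := hh
  have hf : p ∣ f := by
    apply hp.dvd_of_dvd_pow (n := 3)
    rw [show f ^ 3 = g ^ 2 - p * (p ^ 3 * A * f * k ^ 4 + p ^ 5 * B * k ^ 6) by
      linear_combination -he]
    exact dvd_sub (hg.trans (dvd_pow_self g two_ne_zero)) (dvd_mul_right _ _)
  obtain ⟨f, rfl⟩ := hf
  obtain ⟨g, rfl⟩ := hg
  have hp0 := hp.ne_zero
  have hg : p ∣ g := by
    apply hp.dvd_of_dvd_pow (n := 2)
    refine ⟨f ^ 3 + A * f * k ^ 4 * p ^ 2 + B * k ^ 6 * p ^ 3, ?_⟩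
    apply mul_left_cancel₀ (pow_ne_zero 2 hp0)
    linear_combination he
  obtain ⟨g, rfl⟩ := hg
  have hf : p ∣ f := by
    apply hp.dvd_of_dvd_pow (n := 3)
    refine ⟨g ^ 2 - A * f * k ^ 4 * p - B * k ^ 6 * p ^ 2, ?_⟩
    apply mul_left_cancel₀ (pow_ne_zero 3 hp0)
    linear_combination -he
  obtain ⟨f, rfl⟩ := hf
  have hg : p ∣ g := by
    apply hp.dvd_of_dvd_pow (n := 2)
    refine ⟨p * (f ^ 3 + A * f * k ^ 4 + B * k ^ 6), ?_⟩
    apply mul_left_cancel₀ (pow_ne_zero 4 hp0)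
    linear_combination he
  obtain ⟨g, rfl⟩ := hg
  exact ⟨⟨f, by ring⟩, ⟨g, by ring⟩⟩

/-- The relation obtained by differentiating the equation along a derivation that kills its
coefficients; it says that `dx / 2y = dy / (3x² + A)` for `x = f / h²` and `y = g / h³`. -/
theorem derivation_equation (hA : D A = 0) (hB : D B = 0)
    (he : g ^ 2 = f ^ 3 + A * f * h ^ 4 + B * h ^ 6) :
    2 * g * (h * D g - 3 * g * D h) = (3 * f ^ 2 + A * h ^ 4) * (h * D f - 2 * f * D h) := by
  have h1 := congrArg D he
  simp only [map_add, D.leibniz, D.leibniz_pow, smul_eq_mul, nsmul_eq_mul, hA, hB] at h1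
  push_cast at h1
  linear_combination h * h1 - 6 * D h * he

theorem derivation_disc (hA : D A = 0) (hB : D B = 0) : D (4 * A ^ 3 + 27 * B ^ 2) = 0 := by
  have h4 : D (4 : R) = 0 := by exact_mod_cast D.map_natCast 4
  have h27 : D (27 : R) = 0 := by exact_mod_cast D.map_natCast 27
  simp [D.leibniz, D.leibniz_pow, hA, hB, h4, h27]

/-- If a solution that is finite at `p` reduces to a singular point at `p`, then `p` divides the
discriminant. The proof is the Bézout relation between `x³ + A x + B` and its derivative. -/
theorem prime_dvd_disc_of_dvd {p : R} (hp : Prime p)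
    (he : g ^ 2 = f ^ 3 + A * f * h ^ 4 + B * h ^ 6) (hg : p ∣ g) (hs : p ∣ 3 * f ^ 2 + A * h ^ 4)
    (hh : ¬ p ∣ h) : p ∣ 4 * A ^ 3 + 27 * B ^ 2 := by
  have hF : p ∣ f ^ 3 + A * f * h ^ 4 + B * h ^ 6 := by
    rw [← he]; exact hg.trans (dvd_pow_self g two_ne_zero)
  have : p ∣ (4 * A ^ 3 + 27 * B ^ 2) * h ^ 12 := by
    rw [show (4 * A ^ 3 + 27 * B ^ 2) * h ^ 12 =
      (27 * B * h ^ 6 - 27 * f ^ 3 - 27 * A * f * h ^ 4) * (f ^ 3 + A * f * h ^ 4 + B * h ^ 6) +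
      (9 * f ^ 4 + 15 * A * f ^ 2 * h ^ 4 + 4 * A ^ 2 * h ^ 8) * (3 * f ^ 2 + A * h ^ 4) by ring]
    exact dvd_add (hF.mul_left _) (hs.mul_left _)
  exact (hp.dvd_or_dvd this).resolve_right fun h' => hh (hp.dvd_of_dvd_pow h')

/-- The local form of `dvd_mul_derivation_sub` for a solution that is reduced at the prime `p`. -/
theorem pow_dvd_mul_derivation_sub [IsDomain R] [Algebra ℚ R] [WfDvdMonoid R]
    (hA : D A = 0) (hB : D B = 0) (hd : 4 * A ^ 3 + 27 * B ^ 2 ≠ 0) {p : R} (hp : Prime p)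
    (hmin : ¬ (p ^ 4 ∣ A ∧ p ^ 6 ∣ B)) (he : g ^ 2 = f ^ 3 + A * f * h ^ 4 + B * h ^ 6)
    (hg0 : g ≠ 0) (hred : ¬ (p ∣ g ∧ p ∣ h))
    {r : ℕ} (hr : p ^ r ∣ g) : p ^ r ∣ h * D f - 2 * f * D h := by
  have hrel := derivation_equation hA hB he
  set N := h * D f - 2 * f * D h with hN
  set M := h * D g - 3 * g * D h with hM
  set S := 3 * f ^ 2 + A * h ^ 4 with hS
  by_contra hcon
  have hr0 : r ≠ 0 := by rintro rfl; simp at hcon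
  have hpg : p ∣ g := (dvd_pow_self p hr0).trans hr
  have hph : ¬ p ∣ h := fun h' => hred ⟨hpg, h'⟩
  have h2 : ¬ p ∣ (2 : R) := by exact_mod_cast not_prime_dvd_natCast hp two_ne_zero
  -- `n` is the exact order of `N` along `p`.
  have hN0 : N ≠ 0 := by rintro h0; exact hcon (h0 ▸ dvd_zero _)
  obtain ⟨n, N', hN', hNn⟩ := WfDvdMonoid.max_power_factor hN0 hp.irreducible
  have hnN : p ^ n ∣ N := ⟨N', hNn⟩
  have hnN' : ¬ p ^ (n + 1) ∣ N := by
    rw [hNn, pow_succ, mul_dvd_mul_iff_left (pow_ne_zero n hp.ne_zero)]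
    exact hN'
  have hnr : n < r := by
    by_contra! hle
    exact hcon ((pow_dvd_pow p hle).trans hnN)
  have hSp : p ∣ S := by
    have : p ^ (1 + n) ∣ S * N := by
      rw [← hrel, mul_comm 2, mul_assoc]
      exact ((pow_dvd_pow p (by omega)).trans hr).mul_right _
    simpa using prime_pow_dvd_of_dvd_mul_of_not_dvd hp this hnN'
  -- The reduction is singular at `p`, so `p` divides the discriminant, which `D` kills.
  have hDp : p ∣ D p := by
    refine prime_dvd_derivation_self D hp hd (prime_dvd_disc_of_dvd hp he hpg hSp hph)
      (c := 1) hp.not_dvd_one ?_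
    simp [derivation_disc hA hB]
  -- Hence `D` preserves orders along `p`. With `r ≥ n + 1` the relation `2 g M = S N` makes `S`
  -- divisible by `p ^ (2 r - n)`, and then `f`, `g` and `S` are so divisible by `p` that the
  -- Weierstrass equation is not minimal.
  have hMr : p ^ r ∣ M :=
    dvd_sub ((pow_dvd_derivation_of_pow_dvd D hDp hr).mul_left _) ((hr.mul_left _).mul_right _)
  obtain ⟨s, hs⟩ : ∃ s, s + n = 2 * r := ⟨2 * r - n, by omega⟩
  have hSs : p ^ s ∣ S := by
    refine prime_pow_dvd_of_dvd_mul_of_not_dvd hp (?_ : p ^ (s + n) ∣ S * N) hnN'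
    rw [← hrel, hs, two_mul, pow_add, mul_assoc]
    exact (mul_dvd_mul hr hMr).mul_left _
  have hfN : p ^ s ∣ f * N := by
    have h6 : p ^ s ∣ (6 : R) * (f * N) := by
      have hDS : h * D S = 6 * (f * N) + 4 * S * D h := by
        have h3 : D (3 : R) = 0 := by exact_mod_cast D.map_natCast 3
        simp only [hS, map_add, D.leibniz, D.leibniz_pow, smul_eq_mul, nsmul_eq_mul, hA, h3, hN]
        push_cast
        ring
      rw [show 6 * (f * N) = h * D S - 4 * S * D h by rw [hDS]; ring]
      exact dvd_sub ((pow_dvd_derivation_of_pow_dvd D hDp hSs).mul_left _)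
        ((hSs.mul_left _).mul_right _)
    have : ¬ p ∣ (6 : R) := by
      exact_mod_cast not_prime_dvd_natCast (R := R) hp (n := 6) (by norm_num)
    exact hp.pow_dvd_of_dvd_mul_left _ this h6
  have hf2 : p ^ 2 ∣ f := by
    obtain ⟨e, he'⟩ : ∃ e, e + n = s := ⟨s - n, by omega⟩
    exact (pow_dvd_pow p (by omega)).trans
      (prime_pow_dvd_of_dvd_mul_of_not_dvd hp (he' ▸ hfN) hnN')
  have hN2 : p ^ 2 ∣ N :=
    dvd_sub ((pow_dvd_derivation_of_pow_dvd D hDp hf2).mul_left _) ((hf2.mul_left _).mul_right _)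
  have hn2 : 2 ≤ n := by
    by_contra! hlt
    exact hnN' ((pow_dvd_pow p (by omega)).trans hN2)
  have hS4 : p ^ 4 ∣ S := (pow_dvd_pow p (by omega)).trans hSs
  have hg3 : p ^ 3 ∣ g := (pow_dvd_pow p (by omega)).trans hr
  obtain ⟨f', rfl⟩ := hf2
  obtain ⟨g', rfl⟩ := hg3
  obtain ⟨S', hS'⟩ := hS4
  refine hmin ⟨?_, ?_⟩
  · refine hp.pow_dvd_of_dvd_mul_right 4 (fun h' => hph (hp.dvd_of_dvd_pow h')) (b := h ^ 4) ?_
    refine ⟨S' - 3 * f' ^ 2, ?_⟩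
    linear_combination hS'
  · refine hp.pow_dvd_of_dvd_mul_right 6 (fun h' => hph (hp.dvd_of_dvd_pow h')) (b := h ^ 6) ?_
    refine ⟨g' ^ 2 + 2 * f' ^ 3 - f' * S', ?_⟩
    linear_combination -he - p ^ 2 * f' * hS'

/-- **Integrality of the invariant differential.** Let `D` be a derivation that kills the
coefficients of a Weierstrass equation that is minimal at every prime. For a section
`(x, y) = (f / h², g / h³)` the quotient `D x / y = (h * D f - 2 * f * D h) / g` has no poles. -/
theorem dvd_mul_derivation_sub [IsDomain R] [Algebra ℚ R] [UniqueFactorizationMonoid R]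
    (hA : D A = 0) (hB : D B = 0) (hd : 4 * A ^ 3 + 27 * B ^ 2 ≠ 0)
    (hmin : ∀ p, Prime p → ¬ (p ^ 4 ∣ A ∧ p ^ 6 ∣ B))
    (he : g ^ 2 = f ^ 3 + A * f * h ^ 4 + B * h ^ 6) (hh0 : h ≠ 0) :
    g ∣ h * D f - 2 * f * D h := by
  induction h using (wellFounded_dvdNotUnit (α := R)).induction generalizing f g with
  | _ h ih =>
  -- A common prime factor of `g` and `h` is removed by induction on `h`.
  by_cases hred : ∃ p, Prime p ∧ p ∣ g ∧ p ∣ h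
  · obtain ⟨p, hp, hpg, hph⟩ := hred
    obtain ⟨⟨f, rfl⟩, ⟨g, rfl⟩⟩ := sq_dvd_and_cube_dvd_of_equation hp he hpg hph
    obtain ⟨h, rfl⟩ := hph
    have he' : g ^ 2 = f ^ 3 + A * f * h ^ 4 + B * h ^ 6 := by
      apply mul_left_cancel₀ (pow_ne_zero 6 hp.ne_zero)
      linear_combination he
    have hh := right_ne_zero_of_mul hh0
    obtain ⟨u, hu⟩ := ih h ⟨hh, p, hp.not_isUnit, mul_comm _ _⟩ he' hh
    refine ⟨u, ?_⟩
    simp only [D.leibniz, D.leibniz_pow, smul_eq_mul, nsmul_eq_mul]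
    push_cast
    linear_combination p ^ 3 * hu
  push Not at hred
  by_cases hg0 : g = 0
  · subst hg0
    have hrel := derivation_equation hA hB he
    rw [mul_zero, zero_mul, eq_comm, mul_eq_zero] at hrel
    rcases hrel with hS | hN
    · exfalso
      refine mul_ne_zero hd (pow_ne_zero 12 hh0) ?_
      linear_combination
        -(27 * B * h ^ 6 - 27 * f ^ 3 - 27 * A * f * h ^ 4) * he +
        (9 * f ^ 4 + 15 * A * f ^ 2 * h ^ 4 + 4 * A ^ 2 * h ^ 8) * hS
    · rw [hN]
  · refine (UniqueFactorizationMonoid.dvd_iff_emultiplicity_le hg0).2 fun p hp => ?_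
    refine emultiplicity_le_emultiplicity_iff.2 fun r hr => ?_
    exact pow_dvd_mul_derivation_sub hA hB hd hp (hmin p hp) he hg0
      (fun h' => hred p hp h'.1 h'.2) hr

end Integrality

/-! ### Reduction of points of elliptic curves at a place -/

/-- A place of the field `K` with values in the field `κ`, as a relation: `Rel x a` says that `x`
is finite at the place and has the value `a` there. -/
structure Place (K κ : Type*) [Field K] [Field κ] where
  Rel : K → κ → Prop
  unique : ∀ {x a b}, Rel x a → Rel x b → a = b
  one : Rel 1 1
  add : ∀ {x y a b}, Rel x a → Rel y b → Rel (x + y) (a + b)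
  neg : ∀ {x a}, Rel x a → Rel (-x) (-a)
  mul : ∀ {x y a b}, Rel x a → Rel y b → Rel (x * y) (a * b)
  inv : ∀ {x a}, Rel x a → a ≠ 0 → Rel x⁻¹ a⁻¹
  finite_or : ∀ x, (∃ a, Rel x a) ∨ (x ≠ 0 ∧ Rel x⁻¹ 0)

namespace Place

variable {K κ : Type*} [Field K] [Field κ] (v : Place K κ) {x y u w : K} {a b c : κ}

/-- The element `x` has a pole at the place. -/
def Pole (x : K) : Prop := x ≠ 0 ∧ v.Rel x⁻¹ 0

variable {v}

theorem zero : v.Rel 0 0 := by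
  simpa using v.add v.one (v.neg v.one)

theorem sub (hx : v.Rel x a) (hy : v.Rel y b) : v.Rel (x - y) (a - b) := by
  simpa only [sub_eq_add_neg] using v.add hx (v.neg hy)

theorem pow (hx : v.Rel x a) (n : ℕ) : v.Rel (x ^ n) (a ^ n) := by
  induction n with
  | zero => simpa using v.one
  | succ n ih => simpa only [pow_succ] using v.mul ih hx

theorem Pole.not_rel (h : v.Pole x) : ¬ v.Rel x a := by
  intro hx
  have := v.mul hx h.2
  rw [mul_inv_cancel₀ h.1, mul_zero] at this
  exact one_ne_zero (v.unique v.one this)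

theorem rel_of_mul_eq (he : u * x = w) (hu : v.Rel u a) (hw : v.Rel w c) (ha : a ≠ 0) :
    v.Rel x (a⁻¹ * c) := by
  have hu0 : u ≠ 0 := by
    rintro rfl
    exact ha (v.unique hu v.zero)
  rw [show x = u⁻¹ * w by rw [← he, inv_mul_cancel_left₀ hu0]]
  exact v.mul (v.inv hu ha) hw

theorem pole_of_mul_eq (he : u * x = w) (hu : v.Rel u 0) (hw : v.Rel w c) (hc : c ≠ 0) :
    v.Pole x := by
  have hw0 : w ≠ 0 := by
    rintro rfl
    exact hc (v.unique hw v.zero)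
  have hx0 : x ≠ 0 := by
    rintro rfl
    exact hw0 (by rw [← he, mul_zero])
  refine ⟨hx0, ?_⟩
  rw [show x⁻¹ = u * w⁻¹ by rw [← he]; field_simp [left_ne_zero_of_mul (he ▸ hw0)]]
  simpa using v.mul hu (v.inv hw hc)

/-- An element with a finite power is finite. -/
theorem exists_rel_of_sq (h : v.Rel (x ^ 2) a) : ∃ b, v.Rel x b := by
  refine (v.finite_or x).resolve_right fun hp => ?_
  have := v.mul h (v.pow hp.2 2)
  rw [← mul_pow, mul_inv_cancel₀ hp.1, one_pow, zero_pow two_ne_zero, mul_zero] at this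
  exact one_ne_zero (v.unique v.one this)

end Place

section Slope

variable {F : Type*} [Field F] (W : WeierstrassCurve.Affine F) [W.IsShortNF]

theorem equation_of_isShortNF {x y : F} (h : W.Equation x y) :
    y ^ 2 = x ^ 3 + W.a₄ * x + W.a₆ := by
  simpa using (W.equation_iff x y).1 h

theorem negY_of_isShortNF (x y : F) : W.negY x y = -y := by
  simp [WeierstrassCurve.Affine.negY]

/-- Two expressions for the slope, one of which is valid in any situation in which the sum of the
points is not the zero point. -/
theorem mul_slope_of_isShortNF [DecidableEq F] {x₁ y₁ x₂ y₂ : F}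
    (h₁ : W.Equation x₁ y₁) (h₂ : W.Equation x₂ y₂) (hxy : ¬ (x₁ = x₂ ∧ y₁ = -y₂)) :
    (x₁ - x₂) * W.slope x₁ x₂ y₁ y₂ = y₁ - y₂ ∧
      (y₁ + y₂) * W.slope x₁ x₂ y₁ y₂ = x₁ ^ 2 + x₁ * x₂ + x₂ ^ 2 + W.a₄ := by
  have e₁ := equation_of_isShortNF W h₁
  have e₂ := equation_of_isShortNF W h₂
  by_cases hx : x₁ = x₂
  · have hy : y₁ ≠ W.negY x₂ y₂ := by
      rw [negY_of_isShortNF]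
      exact fun h => hxy ⟨hx, h⟩
    have hyy := WeierstrassCurve.Affine.Y_eq_of_Y_ne h₁ h₂ hx hy
    rw [WeierstrassCurve.Affine.slope_of_Y_ne hx hy]
    rw [negY_of_isShortNF] at hy ⊢
    subst hx hyy
    have : y₁ + y₁ ≠ 0 := fun h => hy (eq_neg_of_add_eq_zero_left h)
    refine ⟨by simp, ?_⟩
    rw [sub_neg_eq_add, mul_div_cancel₀ _ this]
    simp
    ring
  · rw [WeierstrassCurve.Affine.slope_of_X_ne hx]
    have := sub_ne_zero.2 hx
    refine ⟨mul_div_cancel₀ _ this, ?_⟩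
    field_simp
    linear_combination e₁ - e₂

end Slope

section Reduction

variable {K κ : Type*} [Field K] [Field κ] (v : Place K κ)
  {W : WeierstrassCurve.Affine K} {W' : WeierstrassCurve.Affine κ}

/-- The point `P` of the curve `W` over `K` reduces to the point `P'` of the curve `W'` over `κ` at
the place `v`. -/
def Reduces : W.Point → W'.Point → Prop
  | .zero, .zero => True
  | .zero, .some _ _ _ => False
  | .some x _ _, .zero => v.Pole x
  | .some x y _, .some x' y' _ => v.Rel x x' ∧ v.Rel y y'

variable {v} {P Q : W.Point} {P' P'' Q' : W'.Point}

theorem Reduces.unique (h₁ : Reduces v P P') (h₂ : Reduces v P P'') : P' = P'' := by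
  rcases P with _ | ⟨x, y, h⟩ <;> rcases P' with _ | ⟨x', y', h'⟩ <;>
    rcases P'' with _ | ⟨x'', y'', h''⟩
  · rfl
  · exact h₂.elim
  · exact h₁.elim
  · exact h₁.elim
  · rfl
  · exact (h₁.not_rel h₂.1).elim
  · exact (Place.Pole.not_rel h₂ h₁.1).elim
  · obtain rfl := v.unique h₁.1 h₂.1
    obtain rfl := v.unique h₁.2 h₂.2
    rfl

variable [W.IsShortNF] [W'.IsShortNF]

theorem Reduces.neg (h : Reduces v P P') : Reduces v (-P) (-P') := by
  rcases P with _ | ⟨x, y, hP⟩ <;> rcases P' with _ | ⟨x', y', hP'⟩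
  · exact h
  · exact h.elim
  · exact h
  · refine ⟨h.1, ?_⟩
    rw [negY_of_isShortNF, negY_of_isShortNF]
    exact v.neg h.2

/-- A point whose first coordinate is finite at the place has a finite reduction. -/
theorem exists_reduces_some [W'.IsElliptic] (h₄ : v.Rel W.a₄ W'.a₄) (h₆ : v.Rel W.a₆ W'.a₆)
    {x y : K} (h : W.Nonsingular x y) {x' : κ}
    (hx : v.Rel x x') : ∃ (y' : κ) (h' : W'.Nonsingular x' y'),
      Reduces v (.some x y h : W.Point) (.some x' y' h' : W'.Point) := by
  have e := equation_of_isShortNF W h.1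
  have hF := v.add (v.add (v.pow hx 3) (v.mul h₄ hx)) h₆
  rw [← e] at hF
  obtain ⟨y', hy⟩ := Place.exists_rel_of_sq hF
  have e' := v.unique (v.pow hy 2) hF
  have : W'.Equation x' y' := by
    rw [WeierstrassCurve.Affine.equation_iff]
    simpa using e'
  exact ⟨y', WeierstrassCurve.Affine.equation_iff_nonsingular.1 this, hx, hy⟩

theorem exists_reduces [W'.IsElliptic] (h₄ : v.Rel W.a₄ W'.a₄) (h₆ : v.Rel W.a₆ W'.a₆)
    (P : W.Point) : ∃ P' : W'.Point, Reduces v P P' := by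
  rcases P with _ | ⟨x, y, h⟩
  · exact ⟨.zero, trivial⟩
  · rcases v.finite_or x with ⟨x', hx⟩ | hx
    · obtain ⟨y', h', H⟩ := exists_reduces_some h₄ h₆ h hx
      exact ⟨_, H⟩
    · exact ⟨.zero, hx⟩

/-- Reduction is additive on a pair of points with finite reductions. The two expressions for the
slope of the line through the points show that it is finite, with the expected value, unless the
reductions have sum zero; in that case one of them shows that the slope has a pole. -/
theorem Reduces.add_some [DecidableEq K] [DecidableEq κ] [W'.IsElliptic]
    (h₄ : v.Rel W.a₄ W'.a₄) {x₁ y₁ x₂ y₂ : K}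
    {a₁ b₁ a₂ b₂ : κ} {h₁ : W.Nonsingular x₁ y₁} {h₂ : W.Nonsingular x₂ y₂}
    {k₁ : W'.Nonsingular a₁ b₁} {k₂ : W'.Nonsingular a₂ b₂}
    (H₁ : Reduces v (.some x₁ y₁ h₁ : W.Point) (.some a₁ b₁ k₁ : W'.Point))
    (H₂ : Reduces v (.some x₂ y₂ h₂ : W.Point) (.some a₂ b₂ k₂ : W'.Point)) :
    Reduces v (.some x₁ y₁ h₁ + .some x₂ y₂ h₂ : W.Point)
      (.some a₁ b₁ k₁ + .some a₂ b₂ k₂ : W'.Point) := by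
  obtain ⟨hx₁, hy₁⟩ := H₁
  obtain ⟨hx₂, hy₂⟩ := H₂
  by_cases hz : x₁ = x₂ ∧ y₁ = -y₂
  · have hz' : a₁ = a₂ ∧ b₁ = -b₂ := by
      obtain ⟨rfl, rfl⟩ := hz
      exact ⟨v.unique hx₁ hx₂, v.unique hy₁ (v.neg hy₂)⟩
    rw [WeierstrassCurve.Affine.Point.add_of_Y_eq hz.1 (by rw [negY_of_isShortNF]; exact hz.2),
      WeierstrassCurve.Affine.Point.add_of_Y_eq hz'.1 (by rw [negY_of_isShortNF]; exact hz'.2)]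
    trivial
  obtain ⟨s₁, s₂⟩ := mul_slope_of_isShortNF W h₁.1 h₂.1 hz
  have hnum := v.add (v.add (v.add (v.pow hx₁ 2) (v.mul hx₁ hx₂)) (v.pow hx₂ 2)) h₄
  rw [WeierstrassCurve.Affine.Point.add_some (by rwa [negY_of_isShortNF])]
  set s := W.slope x₁ x₂ y₁ y₂
  by_cases hz' : a₁ = a₂ ∧ b₁ = -b₂
  · rw [WeierstrassCurve.Affine.Point.add_of_Y_eq hz'.1 (by rw [negY_of_isShortNF]; exact hz'.2)]
    obtain ⟨rfl, rfl⟩ := hz'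
    have hpole : v.Pole s := by
      -- If both numerators vanished, then the reduction would be a singular point.
      by_cases hb : -b₂ - b₂ = 0
      · refine Place.pole_of_mul_eq s₂ (by simpa using v.add hy₁ hy₂) hnum fun hc => ?_
        have := ((W'.nonsingular_iff a₁ (-b₂)).1 k₁).2
        rw [WeierstrassCurve.a₁_of_isShortNF, WeierstrassCurve.a₂_of_isShortNF,
          WeierstrassCurve.a₃_of_isShortNF] at this
        rcases this with h | h
        · exact h (by linear_combination -hc)
        · exact h (by linear_combination hb)
      · exact Place.pole_of_mul_eq s₁ (by simpa using v.sub hx₁ hx₂) (v.sub hy₁ hy₂) hb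
    -- The new `x`-coordinate is `s ^ 2 - x₁ - x₂ = s ^ 2 * (1 - (x₁ + x₂) / s ^ 2)`.
    change v.Pole _
    have hu : v.Rel (1 - (x₁ + x₂) * s⁻¹ ^ 2) 1 := by
      simpa using v.sub v.one (v.mul (v.add hx₁ hx₂) (v.pow hpole.2 2))
    refine Place.pole_of_mul_eq (u := s⁻¹ ^ 2) ?_ (by simpa using v.pow hpole.2 2) hu one_ne_zero
    have := hpole.1
    simp only [WeierstrassCurve.Affine.addX, WeierstrassCurve.a₁_of_isShortNF,
      WeierstrassCurve.a₂_of_isShortNF]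
    field_simp
    ring
  · obtain ⟨t₁, t₂⟩ := mul_slope_of_isShortNF W' k₁.1 k₂.1 hz'
    rw [WeierstrassCurve.Affine.Point.add_some (by rwa [negY_of_isShortNF])]
    set t := W'.slope a₁ a₂ b₁ b₂
    have hst : v.Rel s t := by
      by_cases ha : a₁ - a₂ = 0
      · have hb : b₁ + b₂ ≠ 0 :=
          fun h => hz' ⟨sub_eq_zero.1 ha, eq_neg_of_add_eq_zero_left h⟩
        rw [show t = (b₁ + b₂)⁻¹ * (a₁ ^ 2 + a₁ * a₂ + a₂ ^ 2 + W'.a₄) by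
          rw [← t₂, inv_mul_cancel_left₀ hb]]
        exact Place.rel_of_mul_eq s₂ (v.add hy₁ hy₂) hnum hb
      · rw [show t = (a₁ - a₂)⁻¹ * (b₁ - b₂) by rw [← t₁, inv_mul_cancel_left₀ ha]]
        exact Place.rel_of_mul_eq s₁ (v.sub hx₁ hx₂) (v.sub hy₁ hy₂) ha
    have hX : v.Rel (W.addX x₁ x₂ s) (W'.addX a₁ a₂ t) := by
      simpa [WeierstrassCurve.Affine.addX] using v.sub (v.sub (v.pow hst 2) hx₁) hx₂
    refine ⟨hX, ?_⟩
    have := v.neg (v.add (v.mul hst (v.sub hX hx₁)) hy₁)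
    simpa only [WeierstrassCurve.Affine.addY, negY_of_isShortNF,
      WeierstrassCurve.Affine.negAddY] using this

/-- The sum of a point with finite reduction and a point that reduces to zero has finite
reduction, by an explicit formula for its first coordinate in terms of `1 / x₂` and `y₂ / x₂ ^ 2`,
both of which vanish at the place. -/
theorem Reduces.exists_add_pole [DecidableEq K] [W'.IsElliptic]
    (h₄ : v.Rel W.a₄ W'.a₄) (h₆ : v.Rel W.a₆ W'.a₆) {x₁ y₁ x₂ y₂ : K} {a₁ b₁ : κ}
    {h₁ : W.Nonsingular x₁ y₁} {h₂ : W.Nonsingular x₂ y₂} {k₁ : W'.Nonsingular a₁ b₁}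
    (H₁ : Reduces v (.some x₁ y₁ h₁ : W.Point) (.some a₁ b₁ k₁ : W'.Point)) (H₂ : v.Pole x₂) :
    ∃ (a b : κ) (k : W'.Nonsingular a b),
      Reduces v (.some x₁ y₁ h₁ + .some x₂ y₂ h₂ : W.Point) (.some a b k : W'.Point) := by
  obtain ⟨hx₁, hy₁⟩ := H₁
  have hne : x₁ ≠ x₂ := by
    rintro rfl
    exact H₂.not_rel hx₁
  rw [WeierstrassCurve.Affine.Point.add_some (fun h => hne h.1)]
  have hX : v.Rel (W.addX x₁ x₂ (W.slope x₁ x₂ y₁ y₂)) a₁ := by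
    have e₁ := equation_of_isShortNF W h₁.1
    have e₂ := equation_of_isShortNF W h₂.1
    have hx0 := H₂.1
    have ht := H₂.2
    have hs : v.Rel (y₂ * x₂⁻¹ ^ 2) 0 := by
      have hs2 : v.Rel ((y₂ * x₂⁻¹ ^ 2) ^ 2) 0 := by
        have := v.add (v.add ht (v.mul h₄ (v.pow ht 3))) (v.mul h₆ (v.pow ht 4))
        convert this using 1
        · rw [mul_pow, e₂]
          field_simp
        · simp
      obtain ⟨c, hc⟩ := Place.exists_rel_of_sq hs2
      obtain rfl : c = 0 := pow_eq_zero_iff two_ne_zero |>.1 (v.unique (v.pow hc 2) hs2)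
      exact hc
    have hu : v.Rel ((1 - x₁ * x₂⁻¹) ^ 2) 1 := by
      simpa using v.pow (v.sub v.one (v.mul hx₁ ht)) 2
    have hw : v.Rel (x₁ + (W.a₄ + x₁ ^ 2) * x₂⁻¹ - (y₁ + y₁) * (y₂ * x₂⁻¹ ^ 2) +
        (W.a₆ + y₁ ^ 2 - x₁ ^ 3) * x₂⁻¹ ^ 2) a₁ := by
      simpa using v.add (v.sub (v.add hx₁ (v.mul (v.add h₄ (v.pow hx₁ 2)) ht))
        (v.mul (v.add hy₁ hy₁) hs)) (v.mul (v.sub (v.add h₆ (v.pow hy₁ 2)) (v.pow hx₁ 3))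
          (v.pow ht 2))
    have := Place.rel_of_mul_eq (x := W.addX x₁ x₂ (W.slope x₁ x₂ y₁ y₂)) ?_ hu hw one_ne_zero
    · simpa using this
    · have hd : x₁ - x₂ ≠ 0 := sub_ne_zero.2 hne
      rw [WeierstrassCurve.Affine.slope_of_X_ne hne]
      simp only [WeierstrassCurve.Affine.addX, WeierstrassCurve.a₁_of_isShortNF,
        WeierstrassCurve.a₂_of_isShortNF]
      field_simp
      linear_combination (x₁ - x₂) ^ 2 * e₂
  obtain ⟨b, k, H⟩ := exists_reduces_some h₄ h₆
    (WeierstrassCurve.Affine.nonsingular_add h₁ h₂ fun h => hne h.1) hX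
  exact ⟨_, b, k, H⟩

/-- Reduction of points at a place of good reduction is additive. -/
theorem Reduces.add [DecidableEq K] [DecidableEq κ] [W'.IsElliptic]
    (h₄ : v.Rel W.a₄ W'.a₄) (h₆ : v.Rel W.a₆ W'.a₆)
    (hP : Reduces v P P') (hQ : Reduces v Q Q') : Reduces v (P + Q) (P' + Q') := by
  -- The sum of a point with finite reduction and one that reduces to zero.
  have key : ∀ {P Q : W.Point} {a b : κ} {k : W'.Nonsingular a b},
      Reduces v P (.some a b k : W'.Point) → Reduces v Q (0 : W'.Point) →
        Reduces v (P + Q) (.some a b k : W'.Point) := by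
    rintro (_ | ⟨x₁, y₁, h₁⟩) Q a b k hP hQ
    · exact hP.elim
    rcases Q with _ | ⟨x₂, y₂, h₂⟩
    · exact hP
    obtain ⟨c, d, l, hR⟩ := Reduces.exists_add_pole h₄ h₆ hP hQ (h₂ := h₂)
    generalize hRdef : (.some x₁ y₁ h₁ + .some x₂ y₂ h₂ : W.Point) = R at *
    rcases R with _ | ⟨x₃, y₃, h₃⟩
    · exact hR.elim
    -- The reduction of `P + Q` minus that of `P` is that of `Q`, which is zero.
    have hsub := Reduces.add_some h₄ hR hP.neg
    rw [← WeierstrassCurve.Affine.Point.neg_some h₁, ← WeierstrassCurve.Affine.Point.neg_some k,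
      ← hRdef, add_comm, neg_add_cancel_left] at hsub
    have := hsub.unique hQ
    rw [add_neg_eq_zero] at this
    rwa [this] at hR
  rcases P' with _ | ⟨a₁, b₁, k₁⟩ <;> rcases Q' with _ | ⟨a₂, b₂, k₂⟩
  · obtain ⟨R', hR⟩ := exists_reduces (W' := W') h₄ h₆ (P + Q)
    rcases R' with _ | ⟨a, b, k⟩
    · exact hR
    · have := key hR (Reduces.neg hQ)
      rw [add_neg_cancel_right] at this
      cases this.unique hP
  · rw [add_comm P]
    exact key hQ hP
  · exact key hP hQ
  · rcases P with _ | ⟨x₁, y₁, h₁⟩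
    · exact hP.elim
    rcases Q with _ | ⟨x₂, y₂, h₂⟩
    · exact hQ.elim
    exact Reduces.add_some h₄ hP hQ

end Reduction

/-! ### Sections with a pole along a line, and restriction to a line -/

section PlaneSections

variable {A B f g h : MvPolynomial (Fin 3) ℂ} {n : ℕ}

/-- For degree reasons the integral expression `D x / y` vanishes, so a prime along which `x` has a
pole divides its own derivative. -/
theorem prime_dvd_derivation_of_pole
    {D : Derivation ℤ (MvPolynomial (Fin 3) ℂ) (MvPolynomial (Fin 3) ℂ)}
    (hA : D A = 0) (hB : D B = 0)
    (hd : 4 * A ^ 3 + 27 * B ^ 2 ≠ 0) (hmin : ∀ p, Prime p → ¬ (p ^ 4 ∣ A ∧ p ^ 6 ∣ B))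
    (he : g ^ 2 = f ^ 3 + A * f * h ^ 4 + B * h ^ 6) (hh : h ≠ 0)
    (hdeg : (h * D f - 2 * f * D h).totalDegree < n) (hg : g.IsHomogeneous n)
    {p : MvPolynomial (Fin 3) ℂ} (hp : Prime p) (hph : p ∣ h) (hpf : ¬ p ∣ f) : p ∣ D p := by
  have hN : h * D f - 2 * f * D h = 0 := by
    obtain ⟨u, hu⟩ : g ∣ h * D f - 2 * f * D h := dvd_mul_derivation_sub hA hB hd hmin he hh
    by_contra h0
    have h1 : g ≠ 0 := by
      rintro rfl
      rw [zero_mul] at hu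
      exact h0 hu
    have h2 : u ≠ 0 := by
      rintro rfl
      rw [mul_zero] at hu
      exact h0 hu
    rw [hu, totalDegree_mul_of_isDomain h1 h2, hg.totalDegree h1] at hdeg
    omega
  refine prime_dvd_derivation_self D hp hh hph (c := 2 * f) ?_ ⟨D f, (sub_eq_zero.1 hN).symm⟩
  intro h'
  rcases hp.dvd_or_dvd h' with h2 | h2
  · exact not_prime_dvd_natCast hp two_ne_zero (by exact_mod_cast h2)
  · exact hpf h2

theorem totalDegree_ne_zero_of_prime {p : MvPolynomial (Fin 3) ℂ} (hp : Prime p) :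
    p.totalDegree ≠ 0 := by
  intro h
  rw [totalDegree_eq_zero_iff_eq_C] at h
  have h0 : coeff 0 p ≠ 0 := by
    intro h0
    rw [h0, C_0] at h
    exact hp.ne_zero h
  exact hp.not_isUnit (h ▸ (h0.isUnit.map C))

theorem not_prime_dvd_C {p : MvPolynomial (Fin 3) ℂ} (hp : Prime p) {c : ℂ} (hc : c ≠ 0) :
    ¬ p ∣ C c :=
  fun h => hp.not_isUnit (isUnit_of_dvd_unit h (hc.isUnit.map C))

theorem totalDegree_eq_one_of_pow_dvd {p : MvPolynomial (Fin 3) ℂ} {m : ℕ} (hm : m ≠ 0)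
    (hp : Prime p) {a : MvPolynomial (Fin 3) ℂ} (ha : (p ^ m * a).IsHomogeneous m) (ha0 : a ≠ 0) :
    p.totalDegree = 1 ∧ a = C (coeff 0 a) := by
  have h := ha.totalDegree (mul_ne_zero (pow_ne_zero m hp.ne_zero) ha0)
  have hpow : (p ^ m).totalDegree = m * p.totalDegree := by
    clear h ha hm
    induction m with
    | zero => simp
    | succ k ih =>
      rw [pow_succ, totalDegree_mul_of_isDomain (pow_ne_zero k hp.ne_zero) hp.ne_zero, ih]
      ring
  rw [totalDegree_mul_of_isDomain (pow_ne_zero m hp.ne_zero) ha0, hpow] at h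
  have hpos := Nat.pos_of_ne_zero (totalDegree_ne_zero_of_prime hp)
  have hle : p.totalDegree ≤ 1 := by
    by_contra! hlt
    have := Nat.mul_le_mul_left m hlt
    have := Nat.pos_of_ne_zero hm
    omega
  have h1 : p.totalDegree = 1 := le_antisymm hle hpos
  rw [h1] at h
  exact ⟨h1, totalDegree_eq_zero_iff_eq_C.1 (by omega)⟩

theorem totalDegree_pderiv_le_sub_one {σ R : Type*} [CommRing R] (i : σ) (f : MvPolynomial σ R) :
    (pderiv i f).totalDegree ≤ f.totalDegree - 1 := by
  by_cases hf : f.totalDegree = 0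
  · rw [totalDegree_eq_zero_iff_eq_C.1 hf]; simp
  · exact Nat.le_sub_one_of_lt (totalDegree_pderiv_lt i hf)

theorem totalDegree_mul_sub_lt
    {D : Derivation ℤ (MvPolynomial (Fin 3) ℂ) (MvPolynomial (Fin 3) ℂ)}
    {a b c e N : ℕ} (hf : f.totalDegree ≤ a) (hDf : (D f).totalDegree ≤ b)
    (hh : h.totalDegree ≤ c) (hDh : (D h).totalDegree ≤ e) (h1 : c + b < N) (h2 : a + e < N) :
    (h * D f - 2 * f * D h).totalDegree < N := by
  refine lt_of_le_of_lt (totalDegree_sub _ _) (max_lt ?_ ?_)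
  · exact lt_of_le_of_lt (totalDegree_mul _ _) (by omega)
  · have : (2 : MvPolynomial (Fin 3) ℂ) = C 2 := (map_ofNat C 2).symm
    rw [mul_assoc, this]
    refine lt_of_le_of_lt (totalDegree_mul _ _) ?_
    rw [totalDegree_C]
    have := totalDegree_mul f (D h)
    omega

/-- If the coefficients `A` and `B` are killed by a coefficientwise derivation under which the line
`ℓ` moves, then no section has a pole along `ℓ`. If the Weierstrass equation is not minimal, then
it becomes an equation with constant coefficients after a rescaling, and the partial derivatives
give a stronger result. -/
theorem form_dvd_of_form_dvd (ℓ : Line) {d : Derivation ℤ ℂ ℂ}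
    (hℓ : ¬ ℓ.form ∣ coeffDerivation d ℓ.form) (hA : A.IsHomogeneous 4) (hB : B.IsHomogeneous 6)
    (hdA : ∀ m, d (coeff m A) = 0) (hdB : ∀ m, d (coeff m B) = 0)
    (hd : 4 * A ^ 3 + 27 * B ^ 2 ≠ 0) (hf : f.IsHomogeneous (2 * n + 2))
    (hg : g.IsHomogeneous (3 * n + 3)) (hh : h.IsHomogeneous n)
    (he : g ^ 2 = f ^ 3 + A * f * h ^ 4 + B * h ^ 6) (hh0 : h ≠ 0) (hℓh : ℓ.form ∣ h) :
    ℓ.form ∣ f := by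
  by_contra hℓf
  have hℓp := ℓ.form_irreducible.prime
  by_cases hmin : ∀ p, Prime p → ¬ (p ^ 4 ∣ A ∧ p ^ 6 ∣ B)
  · refine hℓ (prime_dvd_derivation_of_pole (coeffDerivation_eq_zero d hdA)
      (coeffDerivation_eq_zero d hdB) hd hmin he hh0 ?_ hg hℓp hℓh hℓf)
    exact totalDegree_mul_sub_lt hf.totalDegree_le
      ((totalDegree_coeffDerivation_le d f).trans hf.totalDegree_le) hh.totalDegree_le
      ((totalDegree_coeffDerivation_le d h).trans hh.totalDegree_le) (by omega) (by omega)
  push Not at hmin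
  -- For degree reasons `p` is linear and `a`, `b` are constants; `(f, g, p * h)` is a solution of
  -- the Weierstrass equation with coefficients `a`, `b`, which all partial derivatives kill.
  obtain ⟨p, hp, ⟨a, rfl⟩, ⟨b, rfl⟩⟩ := hmin
  have hab : p.totalDegree = 1 ∧ a = C (coeff 0 a) ∧ b = C (coeff 0 b) := by
    by_cases ha0 : a = 0
    · by_cases hb0 : b = 0
      · subst ha0 hb0
        simp at hd
      · obtain ⟨h1, h2⟩ := totalDegree_eq_one_of_pow_dvd (by norm_num) hp hB hb0
        exact ⟨h1, by simp [ha0], h2⟩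
    · obtain ⟨h1, h2⟩ := totalDegree_eq_one_of_pow_dvd (by norm_num) hp hA ha0
      by_cases hb0 : b = 0
      · exact ⟨h1, h2, by simp [hb0]⟩
      · exact ⟨h1, h2, (totalDegree_eq_one_of_pow_dvd (by norm_num) hp hB hb0).2⟩
  obtain ⟨hp1, ha, hb⟩ := hab
  have hd' : 4 * a ^ 3 + 27 * b ^ 2 ≠ 0 := by
    intro h0
    exact hd (by linear_combination p ^ 12 * h0)
  have hmin' : ∀ q, Prime q → ¬ (q ^ 4 ∣ a ∧ q ^ 6 ∣ b) := by
    rintro q hq ⟨h1, h2⟩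
    have ha0 : coeff 0 a = 0 := by
      by_contra h0
      rw [ha] at h1
      exact not_prime_dvd_C hq h0 ((dvd_pow_self q (by norm_num)).trans h1)
    have hb0 : coeff 0 b = 0 := by
      by_contra h0
      rw [hb] at h2
      exact not_prime_dvd_C hq h0 ((dvd_pow_self q (by norm_num)).trans h2)
    rw [ha, hb, ha0, hb0] at hd'
    simp at hd'
  have he' : g ^ 2 = f ^ 3 + a * f * (p * h) ^ 4 + b * (p * h) ^ 6 := by
    rw [he]; ring
  apply ℓ.coeff_ne_zero
  funext i
  by_contra hi
  have hDℓ : ((pderiv i).restrictScalars ℤ : Derivation ℤ _ _) ℓ.form = C (ℓ.coeff i) := by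
    change pderiv i ℓ.form = _
    simp [Line.form, pderiv_X, Pi.single_apply]
  refine not_prime_dvd_C hℓp hi (hDℓ ▸ ?_)
  have hph : (p * h).totalDegree ≤ n + 1 := by
    refine (totalDegree_mul _ _).trans ?_
    have := hh.totalDegree_le
    omega
  refine prime_dvd_derivation_of_pole (D := (pderiv i).restrictScalars ℤ) ?_ ?_ hd' hmin' he'
    (mul_ne_zero hp.ne_zero hh0) ?_ hg hℓp (hℓh.mul_left p) hℓf
  · rw [ha]; exact pderiv_C
  · rw [hb]; exact pderiv_C
  · have h1 := totalDegree_pderiv_le_sub_one i f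
    have h2 := totalDegree_pderiv_le_sub_one i (p * h)
    have := hf.totalDegree_le
    refine totalDegree_mul_sub_lt hf.totalDegree_le (b := 2 * n + 1) ?_ hph (e := n) ?_
      (by omega) (by omega)
    · exact h1.trans (by omega)
    · exact h2.trans (by omega)

end PlaneSections

section PrimePlace

variable {R S : Type*} [CommRing R] [IsDomain R] [CommRing S] [IsDomain S]

/-- The place of the fraction field of `R` at a prime element `p`, with values in the fraction
field of the image of a homomorphism `ρ` with kernel generated by `p`. -/
def primePlace [WfDvdMonoid R] (ρ : R →+* S) {p : R} (hp : Prime p) (hρ : ∀ f, ρ f = 0 ↔ p ∣ f) :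
    Place (FractionRing R) (FractionRing S) where
  Rel x a := ∃ f g, ρ g ≠ 0 ∧
    x = algebraMap R (FractionRing R) f / algebraMap R (FractionRing R) g ∧
    a = algebraMap S (FractionRing S) (ρ f) / algebraMap S (FractionRing S) (ρ g)
  unique := by
    rintro _ _ _ ⟨f, g, hg, rfl, rfl⟩ ⟨f', g', hg', h, rfl⟩
    have g0 : g ≠ 0 := fun h => hg (by rw [h, map_zero])
    have g0' : g' ≠ 0 := fun h => hg' (by rw [h, map_zero])
    rw [div_eq_div_iff (algebraMap_ne_zero g0) (algebraMap_ne_zero g0'), ← map_mul, ← map_mul] at h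
    have := congrArg ρ (IsFractionRing.injective _ _ h)
    rw [div_eq_div_iff (algebraMap_ne_zero hg) (algebraMap_ne_zero hg'), ← map_mul, ← map_mul,
      ← map_mul, ← map_mul, this]
  one := ⟨1, 1, by simp, by simp, by simp⟩
  add := by
    rintro _ _ _ _ ⟨f, g, hg, rfl, rfl⟩ ⟨f', g', hg', rfl, rfl⟩
    have g0 : g ≠ 0 := fun h => hg (by rw [h, map_zero])
    have g0' : g' ≠ 0 := fun h => hg' (by rw [h, map_zero])
    refine ⟨f * g' + g * f', g * g', by simp [hg, hg'], ?_, ?_⟩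
    · rw [div_add_div _ _ (algebraMap_ne_zero g0) (algebraMap_ne_zero g0')]; simp
    · rw [div_add_div _ _ (algebraMap_ne_zero hg) (algebraMap_ne_zero hg')]; simp
  neg := by
    rintro _ _ ⟨f, g, hg, rfl, rfl⟩
    exact ⟨-f, g, hg, by simp [neg_div], by simp [neg_div]⟩
  mul := by
    rintro _ _ _ _ ⟨f, g, hg, rfl, rfl⟩ ⟨f', g', hg', rfl, rfl⟩
    exact ⟨f * f', g * g', by simp [hg, hg'], by simp [div_mul_div_comm],
      by simp [div_mul_div_comm]⟩
  inv := by
    rintro _ _ ⟨f, g, hg, rfl, rfl⟩ h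
    exact ⟨g, f, fun h0 => h (by simp [h0]), by simp, by simp⟩
  finite_or := by
    intro x
    obtain ⟨f, g, hg, rfl⟩ := IsFractionRing.div_surjective (A := R) x
    have g0 := nonZeroDivisors.ne_zero hg
    by_cases f0 : f = 0
    · exact Or.inl ⟨_, 0, 1, by simp, by simp [f0], rfl⟩
    obtain ⟨m, f, hf, rfl⟩ := WfDvdMonoid.max_power_factor f0 hp.irreducible
    obtain ⟨n, g, hpg, rfl⟩ := WfDvdMonoid.max_power_factor g0 hp.irreducible
    have p0 := algebraMap_ne_zero hp.ne_zero
    have hf0 := algebraMap_ne_zero (right_ne_zero_of_mul f0)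
    have hg0 := algebraMap_ne_zero (right_ne_zero_of_mul g0)
    rcases le_or_gt n m with h | h
    · obtain ⟨k, rfl⟩ := Nat.exists_eq_add_of_le h
      refine Or.inl ⟨_, p ^ k * f, g, fun h => hpg ((hρ g).1 h), ?_, rfl⟩
      simp only [map_mul, map_pow]
      field_simp
      ring
    · obtain ⟨k, rfl⟩ := Nat.exists_eq_add_of_lt h
      refine Or.inr ⟨div_ne_zero (algebraMap_ne_zero f0) (algebraMap_ne_zero g0),
        p ^ (k + 1) * g, f, fun h => hf ((hρ f).1 h), ?_, ?_⟩
      · simp only [map_mul, map_pow]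
        field_simp
        ring
      · simp [(hρ p).2 dvd_rfl]

end PrimePlace

section Restriction

variable (Y : EllipticThreefold) (ℓ : Line)

theorem restrict_eq_zero_iff (f : MvPolynomial (Fin 3) ℂ) : ℓ.restrict f = 0 ↔ ℓ.form ∣ f := by
  rw [Ideal.Quotient.mkₐ_eq_mk, Ideal.Quotient.eq_zero_iff_mem, Ideal.mem_span_singleton]

/-- The place of the function field of the plane (more precisely, of its homogeneous coordinate
ring) at a line. -/
def linePlace : Place (FractionRing (MvPolynomial (Fin 3) ℂ)) (FractionRing ℓ.coordRing) :=
  primePlace (ℓ.restrict : MvPolynomial (Fin 3) ℂ →+* ℓ.coordRing) ℓ.form_irreducible.prime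
    (restrict_eq_zero_iff ℓ)

theorem linePlace_rel_div (f : MvPolynomial (Fin 3) ℂ) {g : MvPolynomial (Fin 3) ℂ}
    (hg : ℓ.restrict g ≠ 0) :
    (linePlace ℓ).Rel (algebraMap _ (FractionRing (MvPolynomial (Fin 3) ℂ)) f /
        algebraMap _ (FractionRing (MvPolynomial (Fin 3) ℂ)) g)
      (algebraMap _ (FractionRing ℓ.coordRing) (ℓ.restrict f) /
        algebraMap _ (FractionRing ℓ.coordRing) (ℓ.restrict g)) :=
  ⟨f, g, hg, rfl, rfl⟩

theorem linePlace_rel (f : MvPolynomial (Fin 3) ℂ) :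
    (linePlace ℓ).Rel (algebraMap _ (FractionRing (MvPolynomial (Fin 3) ℂ)) f)
      (algebraMap _ (FractionRing ℓ.coordRing) (ℓ.restrict f)) := by
  simpa using linePlace_rel_div ℓ f (g := 1) (by simp)

instance isShortNF_genericCurve {R : Type*} [CommRing R] [IsDomain R] (a b : R) :
    (genericCurve a b).IsShortNF := ⟨rfl, rfl, rfl⟩

variable {Y ℓ}

theorem isElliptic_genericCurve_restrict (hd : ¬ ℓ.form ∣ Y.disc) :
    (genericCurve (ℓ.restrict Y.A) (ℓ.restrict Y.B)).IsElliptic := by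
  refine ⟨isUnit_iff_ne_zero.2 ?_⟩
  rw [WeierstrassCurve.Δ_of_isShortNF]
  rw [← restrict_eq_zero_iff, EllipticThreefold.disc] at hd
  have h := algebraMap_ne_zero hd
  simp only [map_add, map_mul, map_pow, map_ofNat] at h
  have : CharZero (FractionRing ℓ.coordRing) := algebraRat.charZero _
  exact mul_ne_zero (by norm_num) h

/-- A solution of the weighted homogeneous equation is obtained by rescaling from one in which `g`
and `h` do not both vanish on a given line. -/
theorem exists_reduced_equation {A B : MvPolynomial (Fin 3) ℂ} (ℓ : Line) {n : ℕ}
    {f g h : MvPolynomial (Fin 3) ℂ} (hf : f.IsHomogeneous (2 * n + 2))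
    (hg : g.IsHomogeneous (3 * n + 3)) (hh : h.IsHomogeneous n)
    (he : g ^ 2 = f ^ 3 + A * f * h ^ 4 + B * h ^ 6) (hh0 : h ≠ 0) :
    ∃ (m : ℕ) (t f' g' h' : MvPolynomial (Fin 3) ℂ),
      f = t ^ 2 * f' ∧ g = t ^ 3 * g' ∧ h = t * h' ∧ f'.IsHomogeneous (2 * m + 2) ∧
      g'.IsHomogeneous (3 * m + 3) ∧ h'.IsHomogeneous m ∧
      g' ^ 2 = f' ^ 3 + A * f' * h' ^ 4 + B * h' ^ 6 ∧ ¬ (ℓ.form ∣ g' ∧ ℓ.form ∣ h') := by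
  have hp := ℓ.form_irreducible.prime
  have hp' := ℓ.form_isHomogeneous
  induction n generalizing f g h with
  | zero =>
    refine ⟨0, 1, f, g, h, by ring, by ring, by ring, hf, hg, hh, he, fun e => ?_⟩
    have hC := totalDegree_eq_zero_iff_eq_C.1 (Nat.le_zero.1 hh.totalDegree_le)
    have hd := e.2
    rw [hC] at hd
    refine not_prime_dvd_C hp (fun h0 => hh0 ?_) hd
    rw [hC, h0, C_0]
  | succ n ih =>
    by_cases e : ℓ.form ∣ g ∧ ℓ.form ∣ h
    · obtain ⟨⟨f, rfl⟩, ⟨g, rfl⟩⟩ := sq_dvd_and_cube_dvd_of_equation hp he e.1 e.2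
      obtain ⟨h, rfl⟩ := e.2
      rw [show 2 * (n + 1) + 2 = 1 * 2 + (2 * n + 2) by ring] at hf
      rw [show 3 * (n + 1) + 3 = 1 * 3 + (3 * n + 3) by ring] at hg
      rw [add_comm n 1] at hh
      obtain ⟨m, t, f', g', h', rfl, rfl, rfl, H⟩ :=
        ih (isHomogeneous_right_of_mul (hp'.pow 2) (pow_ne_zero 2 hp.ne_zero) hf)
          (isHomogeneous_right_of_mul (hp'.pow 3) (pow_ne_zero 3 hp.ne_zero) hg)
          (isHomogeneous_right_of_mul hp' hp.ne_zero hh)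
          (mul_left_cancel₀ (pow_ne_zero 6 hp.ne_zero) (by linear_combination he))
          (right_ne_zero_of_mul hh0)
      exact ⟨m, ℓ.form * t, f', g', h', by ring, by ring, by ring, H⟩
    · exact ⟨n + 1, 1, f, g, h, by ring, by ring, by ring, hf, hg, hh, he, e⟩

/-- A rational section is represented by polynomials that do not all vanish on a given line. -/
theorem exists_represents_restrict_ne_zero (σ : Y.MW) : ∃ f g h,
    Represents (homogeneousSubmodule (Fin 3) ℂ) Y.A Y.B σ.1 f g h ∧
      ¬ (ℓ.restrict f = 0 ∧ ℓ.restrict g = 0 ∧ ℓ.restrict h = 0) := by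
  obtain ⟨_ | ⟨x, y, hxy⟩, hσ⟩ := σ
  · obtain ⟨_, ⟨t, ht, rfl⟩, t0⟩ := ℓ.exists_ne_zero
    have t0' : t ≠ 0 := by
      rintro rfl
      exact t0 (map_zero _)
    refine ⟨t ^ 2, t ^ 3, 0, ⟨⟨⟨0, ?_, ?_, zero_mem _⟩, fun e => pow_ne_zero 2 t0' e.1, by ring⟩,
      rfl⟩, fun e => pow_ne_zero 2 t0 ?_⟩
    · simpa using SetLike.pow_mem_graded 2 ht
    · simpa using SetLike.pow_mem_graded 3 ht
    · rw [← e.1, map_pow]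
      rfl
  obtain ⟨f, g, h, ⟨⟨n, hf, hg, hh⟩, -, he⟩, hh0, rfl, rfl⟩ := hσ
  obtain ⟨m, t, f, g, h, rfl, rfl, rfl, hf, hg, hh, he, hr⟩ :=
    exists_reduced_equation ℓ hf hg hh he hh0
  have t0 := algebraMap_ne_zero (left_ne_zero_of_mul hh0)
  have h0 := right_ne_zero_of_mul hh0
  have h0' := algebraMap_ne_zero h0
  refine ⟨f, g, h, ⟨⟨⟨m, hf, hg, hh⟩, fun e => h0 e.2.2, he⟩, h0, ?_, ?_⟩, fun e => hr ?_⟩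
  · simp only [map_mul, map_pow]
    field_simp
  · simp only [map_mul, map_pow]
    field_simp
  · exact ⟨(restrict_eq_zero_iff ℓ g).1 e.2.1, (restrict_eq_zero_iff ℓ h).1 e.2.2⟩

/-- The reduction of a section at a line is its restriction to the line. -/
theorem represents_restrict_of_reduces {P : (genericCurve Y.A Y.B).Point}
    {P' : (genericCurve (ℓ.restrict Y.A) (ℓ.restrict Y.B)).Point}
    (hP : Reduces (linePlace ℓ) P P') {f g h : MvPolynomial (Fin 3) ℂ}
    (hr : Represents (homogeneousSubmodule (Fin 3) ℂ) Y.A Y.B P f g h)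
    (h0 : ¬ (ℓ.restrict f = 0 ∧ ℓ.restrict g = 0 ∧ ℓ.restrict h = 0)) :
    Represents ℓ.grading (ℓ.restrict Y.A) (ℓ.restrict Y.B) P'
      (ℓ.restrict f) (ℓ.restrict g) (ℓ.restrict h) := by
  obtain ⟨⟨⟨n, hf, hg, hh⟩, hne, he⟩, hr⟩ := hr
  have he' := congrArg ℓ.restrict he
  simp only [map_add, map_mul, map_pow] at he'
  refine ⟨⟨⟨n, ℓ.restrict_mem hf, ℓ.restrict_mem hg, ℓ.restrict_mem hh⟩, h0, he'⟩, ?_⟩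
  rcases P with _ | ⟨x, y, hxy⟩
  · rcases P' with _ | ⟨x', y', hxy'⟩
    · change ℓ.restrict h = 0
      rw [show h = 0 from hr, map_zero]
    · exact hP.elim
  obtain ⟨hh0, rfl, rfl⟩ := hr
  by_cases hrh : ℓ.restrict h = 0
  · have hrf : ℓ.restrict f ≠ 0 := by
      intro hrf
      rw [hrf, hrh] at he'
      exact h0 ⟨hrf, by simpa using he', hrh⟩
    have hf0 : f ≠ 0 := fun h => hrf (by rw [h, map_zero])
    have hpole : (linePlace ℓ).Pole (algebraMap _ (FractionRing (MvPolynomial (Fin 3) ℂ)) f /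
        algebraMap _ (FractionRing (MvPolynomial (Fin 3) ℂ)) h ^ 2) := by
      refine ⟨div_ne_zero (algebraMap_ne_zero hf0) (pow_ne_zero 2 (algebraMap_ne_zero hh0)), ?_⟩
      have := linePlace_rel_div ℓ (h ^ 2) hrf
      rw [map_pow ℓ.restrict, hrh, zero_pow two_ne_zero, map_zero, zero_div, map_pow] at this
      rwa [inv_div]
    rcases P' with _ | ⟨x', y', hxy'⟩
    · exact hrh
    · exact (hpole.not_rel hP.1).elim
  · have hX := linePlace_rel_div ℓ f (g := h ^ 2) (by simpa using hrh)
    have hY := linePlace_rel_div ℓ g (g := h ^ 3) (by simpa using hrh)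
    simp only [map_pow] at hX hY
    rcases P' with _ | ⟨x', y', hxy'⟩
    · exact (Place.Pole.not_rel hP hX).elim
    · exact ⟨hrh, (linePlace ℓ).unique hP.1 hX, (linePlace ℓ).unique hP.2 hY⟩

/-- The restriction map is well defined, additive and injective for a line that moves under a
derivation of the complex numbers that kills the coefficients of the elliptic threefold. -/
theorem restrictionInjective_of_derivation {d : Derivation ℤ ℂ ℂ}
    (hdA : ∀ m, d (coeff m Y.A) = 0) (hdB : ∀ m, d (coeff m Y.B) = 0)
    (hℓ : ¬ ℓ.form ∣ coeffDerivation d ℓ.form) : Y.RestrictionInjective ℓ := by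
  have hdisc : ¬ ℓ.form ∣ Y.disc := by
    intro h
    refine hℓ (prime_dvd_derivation_self _ ℓ.form_irreducible.prime Y.disc_ne_zero h (c := 1)
      ℓ.form_irreducible.prime.not_dvd_one ?_)
    rw [derivation_disc (coeffDerivation_eq_zero d hdA) (coeffDerivation_eq_zero d hdB), mul_zero]
    exact dvd_zero _
  refine ⟨hdisc, ?_⟩
  have hE := isElliptic_genericCurve_restrict hdisc
  have h₄ : (linePlace ℓ).Rel (genericCurve Y.A Y.B).a₄
    (genericCurve (ℓ.restrict Y.A) (ℓ.restrict Y.B)).a₄ := linePlace_rel ℓ Y.A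
  have h₆ : (linePlace ℓ).Rel (genericCurve Y.A Y.B).a₆
    (genericCurve (ℓ.restrict Y.A) (ℓ.restrict Y.B)).a₆ := linePlace_rel ℓ Y.B
  choose red hred using fun σ : Y.MW =>
    exists_reduces (W' := genericCurve (ℓ.restrict Y.A) (ℓ.restrict Y.B)) h₄ h₆ σ.1
  choose f g h hrep h0 using fun σ : Y.MW => exists_represents_restrict_ne_zero (ℓ := ℓ) σ
  have hrep' := fun σ => represents_restrict_of_reduces (hred σ) (hrep σ) (h0 σ)
  refine ⟨AddMonoidHom.mk' (fun σ => ⟨red σ, _, _, _, hrep' σ⟩) fun σ τ => ?_,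
    fun σ => ⟨_, _, _, hrep σ, hrep' σ⟩, ?_⟩
  · exact Subtype.ext ((hred (σ + τ)).unique ((hred σ).add h₄ h₆ (hred τ)))
  · rw [injective_iff_map_eq_zero]
    intro σ hσ
    have hσ' : red σ = 0 := congrArg Subtype.val hσ
    have H := hrep σ
    have H' := hrep' σ
    rw [hσ'] at H'
    have hh : ℓ.restrict (h σ) = 0 := H'.2
    rcases hP : σ.1 with _ | ⟨x, y, hxy⟩
    · exact Subtype.ext hP
    · exfalso
      rw [hP] at H
      obtain ⟨⟨⟨n, hf, hg, hh'⟩, -, he⟩, hne, -⟩ := H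
      have hf0 := form_dvd_of_form_dvd ℓ hℓ Y.homogeneous_A Y.homogeneous_B hdA hdB Y.disc_ne_zero
        hf hg hh' he hne ((restrict_eq_zero_iff ℓ _).1 hh)
      rw [← restrict_eq_zero_iff] at hf0
      have he' := H'.1.equation
      rw [hf0, hh] at he'
      exact h0 σ ⟨hf0, by simpa using he', hh⟩

end Restriction

/-! ### Lines that move under a derivation -/

section MovingLines

variable {Y : EllipticThreefold} {ℓ : Line}

/-- A derivation moves a line if it moves the corresponding point of the dual plane. -/
theorem not_form_dvd_coeffDerivation {d : Derivation ℤ ℂ ℂ} {i j : Fin 3}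
    (h : ℓ.coeff i * d (ℓ.coeff j) ≠ ℓ.coeff j * d (ℓ.coeff i)) :
    ¬ ℓ.form ∣ coeffDerivation d ℓ.form := by
  rintro ⟨u, hu⟩
  let v : Fin 3 → ℂ := Pi.single i (ℓ.coeff j) - Pi.single j (ℓ.coeff i)
  have hv : ∀ a : Fin 3 → ℂ, ∑ k, a k * v k = a i * ℓ.coeff j - a j * ℓ.coeff i := fun a => by
    simp [v, mul_sub, Finset.sum_sub_distrib, Pi.single_apply]
  have h1 : eval v ℓ.form = 0 := by
    simp only [Line.form, map_sum, map_mul, eval_C, eval_X, hv]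
    ring
  have h2 := congrArg (eval v) hu
  rw [map_mul, h1, zero_mul] at h2
  simp only [Line.form, map_sum, Derivation.leibniz, coeffDerivation_C, coeffDerivation_X,
    smul_eq_mul, map_mul, eval_C, eval_X, mul_zero, zero_add] at h2
  simp only [mul_comm (v _), hv] at h2
  apply h
  linear_combination -h2

/-- Outside a countable set of slopes, a line moves under some derivation of the complex numbers
that kills the coefficients of the elliptic threefold. -/
theorem exists_countable_forall_derivation_line (Y : EllipticThreefold) :
    ∃ F : Set ℂ, F.Countable ∧ ∀ (w : Fin 3 → ℂ) (i j : Fin 3), w i ≠ 0 → w j / w i ∉ F →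
      ∃ d : Derivation ℤ ℂ ℂ, (∀ m, d (coeff m Y.A) = 0) ∧ (∀ m, d (coeff m Y.B) = 0) ∧
        w i * d (w j) ≠ w j * d (w i) := by
  obtain ⟨F, hF, h⟩ := exists_countable_forall_derivation
    (S := Set.range (fun m => coeff m Y.A) ∪ Set.range fun m => coeff m Y.B)
    ((Set.countable_range _).union (Set.countable_range _))
  refine ⟨F, hF, fun w i j hi hij => ?_⟩
  obtain ⟨d, hd, hne⟩ := h _ hij
  refine ⟨d, fun m => hd _ (Or.inl ⟨m, rfl⟩), fun m => hd _ (Or.inr ⟨m, rfl⟩), fun he => hne ?_⟩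
  rw [Derivation.leibniz_div, smul_eq_mul, smul_eq_mul, smul_eq_mul, he, sub_self, mul_zero]

theorem forVeryGeneralLine_restrictionInjective (Y : EllipticThreefold) :
    ForVeryGeneralLine fun ℓ => Y.RestrictionInjective ℓ := by
  obtain ⟨F, hF, h⟩ := exists_countable_forall_derivation_line Y
  obtain ⟨G, hG⟩ := ((hF.image fun c => (X 1 - C c * X 0 : MvPolynomial (Fin 3) ℂ)).insert
    (X 0)).exists_eq_range (Set.insert_nonempty _ _)
  refine ⟨G, fun i => ?_, fun ℓ hℓ => ?_⟩
  · have hi : G i ∈ Set.range G := ⟨i, rfl⟩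
    rw [← hG] at hi
    obtain h0 | ⟨c, -, hc⟩ := hi
    · rw [h0]
      exact ⟨X_ne_zero 0, 1, isHomogeneous_X ℂ 0⟩
    · rw [← hc]
      refine ⟨fun h0 => ?_, 1, (isHomogeneous_X ℂ 1).sub (isHomogeneous_C_mul_X c 0)⟩
      have := congrArg (eval (Pi.single 1 (1 : ℂ))) h0
      simp at this
  · have hmem : ∀ f ∈ Set.range G, eval ℓ.coeff f ≠ 0 := by
      rintro _ ⟨i, rfl⟩
      exact hℓ i
    rw [← hG] at hmem
    have h0 : ℓ.coeff 0 ≠ 0 := by simpa using hmem (X 0) (Set.mem_insert _ _)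
    obtain ⟨d, hA, hB, hne⟩ := h ℓ.coeff 0 1 h0 fun hF' => by
      have := hmem _ (Set.mem_insert_of_mem _ ⟨_, hF', rfl⟩)
      simp [h0] at this
    exact restrictionInjective_of_derivation hA hB (not_form_dvd_coeffDerivation hne)

end MovingLines

/-! ### Generic points of hypersurfaces over uncountable fields -/

section GenericPoint

variable {k σ : Type*} [Field k] [IsAlgClosed k] [Uncountable k] [Countable σ]

/-- The Nullstellensatz in countably many variables over an uncountable algebraically closed field:
the residue field has countable dimension, whereas a transcendental element `t` would give
uncountably many linearly independent elements `1 / (t - a)`. -/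
theorem exists_eval_eq_zero_of_isMaximal (I : Ideal (MvPolynomial σ k)) [hI : I.IsMaximal] :
    ∃ x : σ → k, ∀ p ∈ I, eval x p = 0 := by
  let _ : Field (MvPolynomial σ k ⧸ I) := Ideal.Quotient.field I
  have halg : Algebra.IsAlgebraic k (MvPolynomial σ k ⧸ I) := by
    refine ⟨fun t => ?_⟩
    by_contra ht
    have hli := (show Transcendental k t from ht).linearIndependent_sub_inv
    have hs : Submodule.span k (Set.range fun m : σ →₀ ℕ =>
        Ideal.Quotient.mkₐ k I (monomial m 1)) = ⊤ := by
      have h1 := congrArg (Submodule.map (Ideal.Quotient.mkₐ k I).toLinearMap)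
        (basisMonomials σ k).span_eq
      rw [Submodule.map_span, ← Set.range_comp, Submodule.map_top,
        LinearMap.range_eq_top.2 (Ideal.Quotient.mkₐ_surjective k I)] at h1
      exact h1
    have hrank : Module.rank k (MvPolynomial σ k ⧸ I) ≤ Cardinal.aleph0 := by
      rw [← rank_top, ← hs]
      exact (rank_span_le _).trans (Cardinal.le_aleph0_iff_set_countable.2 (Set.countable_range _))
    have hle := hli.cardinal_lift_le_rank.trans (Cardinal.lift_le.2 hrank)
    rw [Cardinal.lift_aleph0, Cardinal.lift_le_aleph0, Cardinal.mk_le_aleph0_iff] at hle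
    exact not_countable hle
  have hb := IsAlgClosed.algebraMap_bijective_of_isIntegral (k := k) (K := MvPolynomial σ k ⧸ I)
  choose x hx using fun i => hb.2 (Ideal.Quotient.mk I (X i))
  refine ⟨x, fun p hp => hb.1 ?_⟩
  have key : ∀ p, algebraMap k (MvPolynomial σ k ⧸ I) (eval x p) = Ideal.Quotient.mk I p := by
    intro p
    induction p using MvPolynomial.induction_on with
    | C a => simp; rfl
    | add p q hp hq => rw [map_add, map_add, map_add, hp, hq]
    | mul_X p i hp => rw [map_mul, map_mul, map_mul, hp, eval_X, hx]
  rw [key, map_zero, Ideal.Quotient.eq_zero_iff_mem.2 hp]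

/-- An irreducible hypersurface over an uncountable algebraically closed field has a point outside
any countable family of hypersurfaces that do not contain it. The Nullstellensatz applies to the
coordinate ring with the countably many equations inverted. -/
theorem exists_eval_eq_zero_forall_ne_zero {ι : Type*} [Countable ι] {p : MvPolynomial σ k}
    (hp : Prime p) (g : ι → MvPolynomial σ k) (hg : ∀ i, ¬ p ∣ g i) :
    ∃ v : σ → k, eval v p = 0 ∧ ∀ i, eval v (g i) ≠ 0 := by
  have hpr : (Ideal.span {p}).IsPrime := (Ideal.span_singleton_prime hp.ne_zero).2 hp
  let S := MvPolynomial σ k ⧸ Ideal.span {p}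
  let K := FractionRing S
  let π : MvPolynomial σ k →ₐ[k] K :=
    (IsScalarTower.toAlgHom k S K).comp (Ideal.Quotient.mkₐ k (Ideal.span {p}))
  have hπ : ∀ f, π f = 0 ↔ p ∣ f := by
    intro f
    change algebraMap S K (Ideal.Quotient.mk _ f) = 0 ↔ _
    rw [FaithfulSMul.algebraMap_eq_zero_iff, Ideal.Quotient.eq_zero_iff_mem,
      Ideal.mem_span_singleton]
  let θ : MvPolynomial (σ ⊕ ι) k →ₐ[k] K :=
    aeval (Sum.elim (fun i => π (X i)) fun j => (π (g j))⁻¹)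
  have hθ : ∀ f, θ (rename Sum.inl f) = π f := by
    intro f
    rw [aeval_rename]
    have : aeval (fun i => π (X i)) = π := by ext; simp
    exact congrArg (fun φ : MvPolynomial σ k →ₐ[k] K => φ f) this
  obtain ⟨I, hI, hle⟩ := Ideal.exists_le_maximal (RingHom.ker θ) (RingHom.ker_ne_top _)
  obtain ⟨x, hx⟩ := exists_eval_eq_zero_of_isMaximal I
  have hx' : ∀ f, eval x (rename Sum.inl f) = eval (x ∘ Sum.inl) f := fun f => eval_rename _ _ _
  refine ⟨x ∘ Sum.inl, ?_, fun j hj => ?_⟩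
  · rw [← hx']
    exact hx _ (hle ((hθ p).trans ((hπ p).2 dvd_rfl)))
  · have := hx (rename Sum.inl (g j) * X (Sum.inr j) - 1) (hle ?_)
    · rw [map_sub, map_mul, hx', hj, zero_mul, map_one] at this
      simp at this
    · have h0 : π (g j) ≠ 0 := fun h => hg j ((hπ _).1 h)
      rw [RingHom.mem_ker, map_sub, map_mul, hθ, map_one, aeval_X, Sum.elim_inr,
        mul_inv_cancel₀ h0, sub_self]

end GenericPoint

/-! ### Tangent lines of plane curves -/

section Tangent

variable {q : MvPolynomial (Fin 3) ℂ} {N : ℕ} {v : Fin 3 → ℂ}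

/-- The gradient of a polynomial at a point. -/
def gradient (q : MvPolynomial (Fin 3) ℂ) (v : Fin 3 → ℂ) (i : Fin 3) : ℂ := eval v (pderiv i q)

theorem sum_mul_gradient (hq : q.IsHomogeneous N) : ∑ i, v i * gradient q v i = N * eval v q := by
  have := congrArg (eval v) hq.sum_X_mul_pderiv
  simpa [gradient] using this

/-- The chain rule for a polynomial evaluated along a polynomial curve. -/
theorem derivative_aeval {σ R : Type*} [Fintype σ] [CommRing R] (x : σ → Polynomial R)
    (f : MvPolynomial σ R) :
    Polynomial.derivative (aeval x f) =
      ∑ j, aeval x (pderiv j f) * Polynomial.derivative (x j) := by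
  classical
  induction f using MvPolynomial.induction_on with
  | C a => simp
  | add f g hf hg => simp [hf, hg, add_mul, Finset.sum_add_distrib]
  | mul_X f j hf =>
    have h : ∀ i, aeval x (pderiv i (f * X j)) * Polynomial.derivative (x i) =
        aeval x (pderiv i f) * Polynomial.derivative (x i) * x j +
          if i = j then aeval x f * Polynomial.derivative (x j) else 0 := by
      intro i
      rw [Derivation.leibniz, pderiv_X, smul_eq_mul, smul_eq_mul, map_add, map_mul, map_mul,
        aeval_X]
      by_cases hij : i = j
      · subst hij
        rw [Pi.single_eq_same, map_one, if_pos rfl]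
        ring
      · rw [Pi.single_eq_of_ne' hij, map_zero, if_neg hij]
        ring
    rw [map_mul, aeval_X, Polynomial.derivative_mul, hf, Finset.sum_congr rfl fun i _ => h i,
      Finset.sum_add_distrib, Finset.sum_ite_eq' Finset.univ j, if_pos (Finset.mem_univ j),
      Finset.sum_mul]

theorem eval_aeval {σ R : Type*} [CommRing R] (x : σ → Polynomial R) (f : MvPolynomial σ R)
    (a : R) :
    (aeval x f).eval a = eval (fun i => (x i).eval a) f := by
  induction f using MvPolynomial.induction_on with
  | C a => simp
  | add f g hf hg => simp [hf, hg]
  | mul_X f j hf => simp [hf]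

/-- Vectors orthogonal to both `w` and `z` are proportional to the cross product of `w` and `z`. -/
theorem cross_parallel {w z x : Fin 3 → ℂ} (hw : ∑ i, x i * w i = 0) (hz : ∑ i, x i * z i = 0)
    (i j : Fin 3) :
    (crossProduct w z) i * x j = (crossProduct w z) j * x i := by
  rw [Fin.sum_univ_three] at hw hz
  fin_cases i <;> fin_cases j <;> simp [cross_apply]
  · linear_combination z 2 * hw - w 2 * hz
  · linear_combination -z 1 * hw + w 1 * hz
  · linear_combination -z 2 * hw + w 2 * hz
  · linear_combination z 0 * hw - w 0 * hz
  · linear_combination z 1 * hw - w 1 * hz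
  · linear_combination -z 0 * hw + w 0 * hz

theorem eval_smul_of_isHomogeneous {σ R : Type*} [Fintype σ] [CommRing R] {q : MvPolynomial σ R}
    (hq : q.IsHomogeneous N) (b : R) (x : σ → R) :
    eval (fun i => b * x i) q = b ^ N * eval x q := by
  rw [eval_eq', eval_eq', Finset.mul_sum]
  refine Finset.sum_congr rfl fun m hm => ?_
  have hmN : ∑ i, m i = N := by
    rw [hq.degree_eq_sum_deg_support hm]
    exact (Finset.sum_subset (Finset.subset_univ _) fun i _ hi => by simpa using hi).symm
  simp only [mul_pow, Finset.prod_mul_distrib, Finset.prod_pow_eq_pow_sum, hmN]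
  ring

/-- If a form of degree at least `3` has no zero on the line through `v` and `u`, except possibly
`v`, then its restriction to this line is a multiple of a power of a linear form, so its second
derivative at `v` in the direction `u` is zero. -/
theorem sum_hessian_eq_zero (hq : q.IsHomogeneous N) (hN : 3 ≤ N) {u : Fin 3 → ℂ}
    (h : ∀ a : ℂ, eval (fun i => a * v i + u i) q ≠ 0) :
    ∑ i, ∑ j, u i * u j * eval v (pderiv j (pderiv i q)) = 0 := by
  -- `Q` is the restriction of `q` to the line in the affine coordinate at `u`, and `aeval x q` that
  -- in the affine coordinate at `v`.
  set Q : Polynomial ℂ :=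
    aeval (fun i => Polynomial.X * Polynomial.C (v i) + Polynomial.C (u i)) q with hQ
  have hQe : ∀ a, Q.eval a = eval (fun i => a * v i + u i) q := by
    intro a
    rw [hQ, eval_aeval]
    simp only [Polynomial.eval_add, Polynomial.eval_mul, Polynomial.eval_C, Polynomial.eval_X]
  have hdeg : Q.degree ≤ 0 := by
    by_contra hd
    obtain ⟨a, ha⟩ := IsAlgClosed.exists_root Q (fun h0 => hd h0.le)
    exact h a ((hQe a).symm.trans ha)
  obtain ⟨c, hc⟩ : ∃ c, Q = Polynomial.C c := ⟨_, Polynomial.eq_C_of_degree_le_zero hdeg⟩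
  set x : Fin 3 → Polynomial ℂ := fun i =>
    Polynomial.C (v i) + Polynomial.C (u i) * Polynomial.X with hx
  have hx' : ∀ i, Polynomial.derivative (x i) = Polynomial.C (u i) := fun i => by simp [hx]
  have hP : aeval x q = Polynomial.C c * Polynomial.X ^ N := by
    refine Polynomial.eq_of_infinite_eval_eq _ _
      ((Set.finite_singleton (0 : ℂ)).infinite_compl.mono fun b hb => ?_)
    have hb : b ≠ 0 := hb
    have hline : (fun i => (x i).eval b) = fun i => b * (b⁻¹ * v i + u i) := by
      funext i
      simp only [hx, Polynomial.eval_add, Polynomial.eval_mul, Polynomial.eval_C, Polynomial.eval_X]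
      rw [mul_add, mul_inv_cancel_left₀ hb, mul_comm]
    change (aeval x q).eval b = _
    rw [eval_aeval, hline, eval_smul_of_isHomogeneous hq b, ← hQe, hc]
    rw [Polynomial.eval_C, Polynomial.eval_mul, Polynomial.eval_C, Polynomial.eval_pow,
      Polynomial.eval_X, mul_comm]
  have hD : ∀ f : MvPolynomial (Fin 3) ℂ, Polynomial.derivative (aeval x f) =
      ∑ i, aeval x (pderiv i f) * Polynomial.C (u i) := by
    intro f
    rw [derivative_aeval]
    exact Finset.sum_congr rfl fun i _ => by rw [hx']
  have hx0 : (fun i => (x i).eval 0) = v := by funext i; simp [hx]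
  have h2 : (Polynomial.derivative (Polynomial.derivative (aeval x q))).eval 0 = 0 := by
    obtain ⟨k, rfl⟩ := Nat.exists_eq_add_of_le' hN
    rw [hP, Polynomial.derivative_C_mul_X_pow, Polynomial.derivative_C_mul_X_pow]
    simp
  rw [← h2, hD, Polynomial.derivative_sum, Polynomial.eval_finsetSum]
  refine Finset.sum_congr rfl fun i _ => ?_
  rw [Polynomial.derivative_mul, Polynomial.derivative_C, mul_zero, add_zero, hD,
    Polynomial.eval_mul, Polynomial.eval_C, Polynomial.eval_finsetSum, Finset.sum_mul]
  refine Finset.sum_congr rfl fun j _ => ?_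
  rw [Polynomial.eval_mul, Polynomial.eval_C, eval_aeval, hx0]
  ring

theorem pderiv_pderiv_comm {σ R : Type*} [CommRing R] (i j : σ) (f : MvPolynomial σ R) :
    pderiv i (pderiv j f) = pderiv j (pderiv i f) := by
  classical
  have h : ⁅pderiv (R := R) i, pderiv (R := R) j⁆ = 0 := by
    refine MvPolynomial.derivation_ext fun k => ?_
    rw [Derivation.commutator_apply, pderiv_X, pderiv_X, Derivation.zero_apply]
    simp only [Pi.single_apply]
    split_ifs <;> simp
  exact sub_eq_zero.1 (by rw [← Derivation.commutator_apply, h, Derivation.zero_apply])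

/-- Let `q = 0` be a curve of degree at least `3` whose equation is preserved by a derivation `d`
of the coefficients, and `v` a point of it whose tangent line is not preserved by `d`. Then the
tangent line has another point in common with the curve. Indeed the tangent line is spanned by `v`
and the velocity `d v`. If it met the curve in `v` only, then the Hessian at `v` would vanish on
`d v`, so that `v` and `d v`, which are orthogonal to `gradient q v`, would also be orthogonal to
its derivative, and hence parallel. -/
theorem exists_eval_eq_zero_on_tangent {d : Derivation ℤ ℂ ℂ} (hq : q.IsHomogeneous N) (hN : 3 ≤ N)
    {c : ℂ} (hD : coeffDerivation d q = C c * q) (hv : eval v q = 0)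
    (hw : ∃ i j, gradient q v i * d (gradient q v j) ≠ gradient q v j * d (gradient q v i)) :
    ∃ x, LinearIndependent ℂ ![v, x] ∧ eval x q = 0 ∧ ∑ i, x i * gradient q v i = 0 := by
  set w := gradient q v with hwdef
  set u : Fin 3 → ℂ := fun i => d (v i) with hu
  set H : Fin 3 → Fin 3 → ℂ := fun i j => eval v (pderiv j (pderiv i q)) with hH
  have hHs : ∀ i j, H i j = H j i := fun i j => by simp only [hH]; rw [pderiv_pderiv_comm]
  have hvw : ∑ i, v i * w i = 0 := by rw [hwdef, sum_mul_gradient hq, hv, mul_zero]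
  have huw : ∑ i, u i * w i = 0 := by
    have h := derivation_eval d q v
    rw [hv, map_zero, hD, map_mul, hv, mul_zero, zero_add] at h
    rw [h]
    exact Finset.sum_congr rfl fun i _ => mul_comm _ _
  have hdw : ∀ i, d (w i) = c * w i + ∑ j, H i j * u j := by
    intro i
    have h := derivation_eval d (pderiv i q) v
    rwa [coeffDerivation_pderiv, hD, pderiv_C_mul, map_mul, eval_C] at h
  have hvH : ∀ i, ∑ j, v j * H i j = (N - 1 : ℕ) * w i := fun i =>
    sum_mul_gradient (v := v) (hq.pderiv (i := i))
  have hv0 : v ≠ 0 := by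
    rintro rfl
    have h : ∀ i, w i = 0 := by
      intro i
      change eval 0 (pderiv i q) = 0
      have h := eval_smul_of_isHomogeneous (hq.pderiv (i := i)) 0 0
      simpa [zero_pow (show N - 1 ≠ 0 by omega), ← Pi.zero_def] using h
    obtain ⟨i, j, hij⟩ := hw
    simp [h] at hij
  -- The velocity of the point is not parallel to `v`: by Euler's formula for the partial
  -- derivatives, the tangent line would be preserved.
  have hpar : ∀ t : ℂ, ¬ ∀ i, u i = t * v i := by
    intro t ht
    have h : ∀ i, d (w i) = (c + t * (N - 1 : ℕ)) * w i := by
      intro i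
      rw [hdw, add_mul, mul_assoc, ← hvH, Finset.mul_sum]
      congr 1
      exact Finset.sum_congr rfl fun j _ => by rw [ht]; ring
    obtain ⟨i, j, hij⟩ := hw
    apply hij
    rw [h, h]
    ring
  have hv2 : ∑ i, v i * d (w i) = 0 := by
    calc ∑ i, v i * d (w i) = c * ∑ i, v i * w i + ∑ j, u j * ∑ i, v i * H j i := by
          simp only [hdw, Fin.sum_univ_three]
          rw [hHs 1 0, hHs 2 0, hHs 2 1]
          ring
      _ = 0 := by
          simp only [hvH]
          rw [hvw, mul_zero, zero_add]
          calc _ = ((N - 1 : ℕ) : ℂ) * ∑ i, u i * w i := by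
                rw [Finset.mul_sum]
                exact Finset.sum_congr rfl fun j _ => by ring
            _ = 0 := by rw [huw, mul_zero]
  obtain ⟨a, ha⟩ : ∃ a : ℂ, eval (fun i => a * v i + u i) q = 0 := by
    by_contra! hcon
    have hu2 : ∑ i, u i * d (w i) = 0 := by
      calc ∑ i, u i * d (w i) = c * ∑ i, u i * w i + ∑ i, ∑ j, u i * u j * H i j := by
            simp only [hdw, Fin.sum_univ_three]
            ring
        _ = 0 := by
            rw [huw, mul_zero, zero_add]
            exact sum_hessian_eq_zero hq hN hcon
    have hcv := cross_parallel (w := w) (z := fun i => d (w i)) hvw hv2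
    have hcu := cross_parallel (w := w) (z := fun i => d (w i)) huw hu2
    obtain ⟨k, hk⟩ : ∃ k, (crossProduct w fun i => d (w i)) k ≠ 0 := by
      by_contra! h0
      have e0 := h0 0
      have e1 := h0 1
      have e2 := h0 2
      simp [cross_apply] at e0 e1 e2
      obtain ⟨i, j, hij⟩ := hw
      apply hij
      fin_cases i <;> fin_cases j <;> simp <;>
        first
        | linear_combination e0
        | linear_combination e1
        | linear_combination e2
        | linear_combination -e0
        | linear_combination -e1
        | linear_combination -e2
    have hvk : v k ≠ 0 := by
      intro h0
      apply hv0
      funext j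
      have := hcv k j
      rw [h0, mul_zero] at this
      exact (mul_eq_zero.1 this).resolve_left hk
    refine hpar (u k / v k) fun j => ?_
    have e1 := hcv k j
    have e2 := hcu k j
    rw [div_mul_eq_mul_div, eq_div_iff hvk]
    apply mul_left_cancel₀ hk
    linear_combination v k * e2 - u k * e1
  refine ⟨fun i => a * v i + u i, ?_, ha, ?_⟩
  · rw [LinearIndependent.pair_iff]
    intro s t hst
    have hst' : ∀ i, s * v i + t * (a * v i + u i) = 0 := fun i => by
      simpa using congrFun hst i
    have ht : t = 0 := by
      by_contra ht
      refine hpar (-(s / t + a)) fun i => ?_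
      have := hst' i
      field_simp
      linear_combination this
    subst ht
    refine ⟨?_, rfl⟩
    obtain ⟨i, hi⟩ := Function.ne_iff.1 hv0
    have := hst' i
    rw [zero_mul, add_zero] at this
    exact (mul_eq_zero.1 this).resolve_right hi
  · simp only [add_mul, mul_assoc, Finset.sum_add_distrib, ← Finset.mul_sum, hvw, huw]
    ring

end Tangent

/-! ### Tangent lines of the discriminant curve -/

section Disc

variable {Y : EllipticThreefold}

theorem reducedEquation_dvd (F : MvPolynomial (Fin 3) ℂ) : reducedEquation F ∣ F := by
  let _ := UniqueFactorizationMonoid.strongNormalizationMonoid (α := MvPolynomial (Fin 3) ℂ)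
  exact UniqueFactorizationMonoid.radical_dvd_self

theorem squarefree_reducedEquation (F : MvPolynomial (Fin 3) ℂ) :
    Squarefree (reducedEquation F) := by
  let _ := UniqueFactorizationMonoid.strongNormalizationMonoid (α := MvPolynomial (Fin 3) ℂ)
  exact UniqueFactorizationMonoid.squarefree_radical

theorem reducedDisc_ne_zero (Y : EllipticThreefold) : Y.reducedDisc ≠ 0 :=
  (squarefree_reducedEquation _).ne_zero

/-- If `D` kills `x`, then it preserves every hypersurface contained in `x = 0`. -/
theorem dvd_derivation_self_of_dvd {R : Type*} [CommRing R] [IsDomain R] [Algebra ℚ R]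
    [UniqueFactorizationMonoid R] (D : Derivation ℤ R R) {x q : R} (hx : x ≠ 0) (hD : D x = 0)
    (hq : q ∣ x) : q ∣ D q := by
  rw [UniqueFactorizationMonoid.dvd_iff_emultiplicity_le (ne_zero_of_dvd_ne_zero hx hq)]
  intro p hp
  rw [emultiplicity_le_emultiplicity_iff]
  intro n hn
  rcases eq_or_ne n 0 with rfl | h0
  · simp
  · refine pow_dvd_derivation_of_pow_dvd D ?_ hn
    exact prime_dvd_derivation_self D hp hx ((dvd_pow_self p h0).trans (hn.trans hq))
      hp.not_dvd_one (by rw [hD, mul_zero]; exact dvd_zero _)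

theorem exists_coeffDerivation_reducedDisc {d : Derivation ℤ ℂ ℂ}
    (hdA : ∀ m, d (coeff m Y.A) = 0) (hdB : ∀ m, d (coeff m Y.B) = 0) :
    ∃ c, coeffDerivation d Y.reducedDisc = C c * Y.reducedDisc := by
  obtain ⟨r, hr⟩ := dvd_derivation_self_of_dvd (coeffDerivation d) Y.disc_ne_zero
    (derivation_disc (coeffDerivation_eq_zero d hdA) (coeffDerivation_eq_zero d hdB))
    (reducedEquation_dvd Y.disc)
  change coeffDerivation d Y.reducedDisc = Y.reducedDisc * r at hr
  rcases eq_or_ne r 0 with rfl | hr0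
  · exact ⟨0, by rw [hr]; simp⟩
  have h := totalDegree_coeffDerivation_le d Y.reducedDisc
  rw [hr, totalDegree_mul_of_isDomain (reducedDisc_ne_zero Y) hr0] at h
  have h0 : r.totalDegree = 0 := by omega
  exact ⟨coeff 0 r, by rw [hr, mul_comm, ← totalDegree_eq_zero_iff_eq_C.1 h0]⟩

theorem disc_isHomogeneous (Y : EllipticThreefold) : Y.disc.IsHomogeneous 12 := by
  have h4 : (4 * Y.A ^ 3).IsHomogeneous 12 := (Y.homogeneous_A.pow 3).C_mul 4
  exact h4.add ((Y.homogeneous_B.pow 2).C_mul 27)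

theorem exists_reducedDisc_isHomogeneous (Y : EllipticThreefold) :
    ∃ N, Y.reducedDisc.IsHomogeneous N :=
  exists_isHomogeneous_of_dvd (disc_isHomogeneous Y) Y.disc_ne_zero (reducedEquation_dvd _)

/-- A discriminant curve that is neither a union of lines nor an irreducible conic has degree at
least `3` and a component of degree at least `2`. -/
theorem exists_irreducible_factor_reducedDisc {N : ℕ} (hN : Y.reducedDisc.IsHomogeneous N)
    (hlin : ¬ IsUnionOfLines Y.reducedDisc) (hcon : ¬ IsIrreducibleConic Y.reducedDisc) :
    3 ≤ N ∧ ∃ p r, Irreducible p ∧ 2 ≤ p.totalDegree ∧ ¬ p ∣ r ∧ Y.reducedDisc = p * r := by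
  unfold IsUnionOfLines at hlin
  push Not at hlin
  obtain ⟨p, hp, ⟨r, hr⟩, hp1⟩ := hlin
  have hq0 := reducedDisc_ne_zero Y
  obtain ⟨m, hm⟩ := exists_isHomogeneous_of_dvd hN hq0 ⟨r, hr⟩
  have hpm := hm.totalDegree hp.ne_zero
  have hp2 : 2 ≤ p.totalDegree := by
    have h0 := totalDegree_ne_zero_of_prime hp.prime
    have h1 : p.totalDegree ≠ 1 := fun h => hp1 (by rwa [← h, hpm])
    omega
  have hr0 : r ≠ 0 := by
    rintro rfl
    exact hq0 (by rw [hr, mul_zero])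
  have hdeg : N = p.totalDegree + r.totalDegree := by
    rw [← hN.totalDegree hq0, hr, totalDegree_mul_of_isDomain hp.ne_zero hr0]
  refine ⟨?_, p, r, hp, hp2, ?_, hr⟩
  · by_contra hN3
    have h0 : r.totalDegree = 0 := by omega
    have hN2 : N = 2 := by omega
    rw [totalDegree_eq_zero_iff_eq_C] at h0
    have hc : coeff 0 r ≠ 0 := by
      intro hc
      rw [hc, C_0] at h0
      exact hr0 h0
    have hru : IsUnit r := h0 ▸ hc.isUnit.map C
    exact hcon ⟨by rw [hr]; exact (irreducible_mul_isUnit hru).2 hp, hN2 ▸ hN⟩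
  · intro h
    exact hp.not_isUnit (squarefree_reducedEquation Y.disc p
      ((mul_dvd_mul_left p h).trans hr.symm.dvd))

/-- A component `p = 0` of degree at least `2` of a reduced curve `p * r = 0` has a smooth point
whose tangent line has a slope outside a given countable set. Such a point is a generic point of
the component: since the component is not a line, its points satisfy no linear equation with
coefficients in a countable set. -/
theorem exists_generic_tangent {F : Set ℂ} (hF : F.Countable) {N : ℕ}
    {p r : MvPolynomial (Fin 3) ℂ} (hN : (p * r).IsHomogeneous N)
    (hp : Irreducible p) (hp2 : 2 ≤ p.totalDegree) (hpr : ¬ p ∣ r) :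
    ∃ v, eval v (p * r) = 0 ∧ ∃ i j, gradient (p * r) v i ≠ 0 ∧
      gradient (p * r) v j / gradient (p * r) v i ∉ F := by
  obtain ⟨i, hi⟩ := exists_pderiv_ne_zero (totalDegree_ne_zero_of_prime hp.prime)
  have hpi : ¬ p ∣ pderiv i p := fun h =>
    (totalDegree_le_of_dvd_of_isDomain h hi).not_gt
      (totalDegree_pderiv_lt i (totalDegree_ne_zero_of_prime hp.prime))
  let L : (Fin 3 → F) → Line := fun t => ⟨Function.update (fun j => (t j : ℂ)) i 1, fun h => by
    simpa using congrFun h i⟩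
  have hL : ∀ t, ¬ p ∣ (L t).form := fun t h => by
    have := totalDegree_le_of_dvd_of_isDomain h (L t).form_ne_zero
    rw [(L t).form_isHomogeneous.totalDegree (L t).form_ne_zero] at this
    omega
  have := hF.to_subtype
  have : Uncountable ℂ := Set.not_countable_univ_iff.1 not_countable_complex
  obtain ⟨v, hv, hg⟩ := exists_eval_eq_zero_forall_ne_zero hp.prime
    (fun o : Option (Fin 3 → F) => o.elim (r * pderiv i p) fun t => (L t).form) fun o => by
      cases o with
      | none => exact fun h => (hp.prime.dvd_or_dvd h).elim hpr hpi
      | some t => exact hL t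
  have hwi : gradient (p * r) v i ≠ 0 := by
    have h0 : eval v (r * pderiv i p) ≠ 0 := hg none
    rw [map_mul] at h0
    rw [gradient, pderiv_mul, map_add, map_mul, map_mul, hv, zero_mul, add_zero, mul_comm]
    exact h0
  have hv' : eval v (p * r) = 0 := by rw [map_mul, hv, zero_mul]
  refine ⟨v, hv', i, ?_⟩
  by_contra! hcon
  have hcon' := fun j => hcon j hwi
  apply hg (some fun j => ⟨_, hcon' j⟩)
  have h1 : ∀ j, Function.update (fun j => gradient (p * r) v j / gradient (p * r) v i) i 1 j =
      gradient (p * r) v j / gradient (p * r) v i := by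
    intro j
    rcases eq_or_ne j i with rfl | h
    · rw [Function.update_self, div_self hwi]
    · rw [Function.update_of_ne h]
  have h2 := sum_mul_gradient (v := v) hN
  rw [hv', mul_zero] at h2
  simp only [Option.elim_some, L, Line.form, map_sum, map_mul, eval_C, eval_X, h1]
  rw [← zero_div (gradient (p * r) v i), ← h2, Finset.sum_div]
  exact Finset.sum_congr rfl fun j _ => by ring

theorem exists_tangent_restrictionInjective (hlin : ¬ IsUnionOfLines Y.reducedDisc)
    (hcon : ¬ IsIrreducibleConic Y.reducedDisc) :
    ∃ ℓ : Line, ℓ.IsTangentTo Y.reducedDisc ∧ ℓ.MeetsInTwoPoints Y.reducedDisc ∧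
      Y.RestrictionInjective ℓ := by
  obtain ⟨N, hN⟩ := exists_reducedDisc_isHomogeneous Y
  obtain ⟨hN3, p, r, hp, hp2, hpr, hq⟩ := exists_irreducible_factor_reducedDisc hN hlin hcon
  obtain ⟨F, hF, hder⟩ := exists_countable_forall_derivation_line Y
  obtain ⟨v, hv, i, j, hi, hij⟩ := exists_generic_tangent hF (hq ▸ hN) hp hp2 hpr
  rw [← hq] at hv hi hij
  obtain ⟨d, hdA, hdB, hne⟩ := hder _ i j hi hij
  obtain ⟨c, hc⟩ := exists_coeffDerivation_reducedDisc hdA hdB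
  obtain ⟨x, hvx, hx, hxw⟩ := exists_eval_eq_zero_on_tangent hN hN3 hc hv ⟨i, j, hne⟩
  have hform : ∀ (h : gradient Y.reducedDisc v ≠ 0) (y : Fin 3 → ℂ),
      eval y (Line.form ⟨_, h⟩) = ∑ k, y k * gradient Y.reducedDisc v k := by
    intro h y
    simp only [Line.form, map_sum, map_mul, eval_C, eval_X, mul_comm]
  have hw : gradient Y.reducedDisc v ≠ 0 := fun h => hi (congrFun h i)
  refine ⟨⟨_, hw⟩, ⟨v, hvx.ne_zero 0, hv, 1, one_ne_zero, fun k => (one_mul _).symm⟩,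
    ⟨v, x, hvx, ⟨?_, hv⟩, ?_, hx⟩, ?_⟩
  · rw [hform, sum_mul_gradient hN, hv, mul_zero]
  · rw [hform, hxw]
  · exact restrictionInjective_of_derivation hdA hdB (not_form_dvd_coeffDerivation hne)

end Disc

end EllThreefold

end

open EllThreefold

theorem mainTheorem3 (Y : EllipticThreefold) :
    ForVeryGeneralLine (fun ℓ => Y.RestrictionInjective ℓ) ∧
    (¬ IsUnionOfLines Y.reducedDisc → ¬ IsIrreducibleConic Y.reducedDisc →
      ∃ ℓ : Line, ℓ.IsTangentTo Y.reducedDisc ∧ ℓ.MeetsInTwoPoints Y.reducedDisc ∧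
        Y.RestrictionInjective ℓ) :=
  ⟨forVeryGeneralLine_restrictionInjective Y, exists_tangent_restrictionInjective⟩
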